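/- Let $k$ be a field. Let $v$ be a partial diagram on a row of $l$ dots: a set partition of $\{1,\dots,l\}$ together with a choice of exactly $n$ of its parts, called labelled. Number the labelled parts $P_1,\dots,P_n$ from left to right by their leftmost dots, let $\alpha_i$ be the number of labelled parts of size $i$, let $l_1=\sum_i i\,\alpha_i$ be the number of dots on labelled parts, and let $\Sigma_{l_1}$ be the symmetric group on these dots. Let $d$ be the diagram with top row $v$ and $n$ bottom dots, whose $j$-th bottom dot is joined to $P_j$. For $\zeta\in\Sigma_{l_1}$ let $\zeta d$ be the diagram obtained by writing the diagram of $\zeta$ (fixing all other dots) on top of $d$, and for a diagram $b$ with $n$ bottom dots lying on $n$ different propagating parts let $\Pi(b)\in\Sigma_n$ be the permutation induced by its propagating lines, where the propagating parts of the top row are numbered from left to right by their leftmost dots. Let $\prod_\alpha\subseteq\Sigma_{l_1}$ be the stabilizer of the set of labelled parts; it is isomorphic to $\prod_i \Sigma_i\wr\Sigma_{\alpha_i}$ and acts on $k\Sigma_n$ by $\zeta\cdot\eta=\Pi(\zeta d)\eta$. Let $\Sigma_\gamma=\prod_j\Sigma_{P_j}\subseteq\prod_\alpha$, a Young subgroup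 of type $\gamma=(1^{\alpha_1},2^{\alpha_2},\dots)$, and let $\Sigma_\alpha\subseteq\Sigma_n$ be the Young subgroup of those $\sigma$ with $|P_{\sigma(j)}|=|P_j|$ for all $j$. Fix representatives $\sigma_1,\dots,\sigma_s$ of the right cosets $\Sigma_\alpha\backslash\Sigma_n$. The tensor induced module is the $(k\Sigma_{l_1},k\Sigma_n)$-bimodule $\bigoplus_{i=1}^s k\Sigma_{l_1}\otimes_{k\Sigma_\gamma}k$ with the obvious left action and with the right action $$(\tau\otimes 1)^{(i)}\cdot\eta=(\tau\hat\vartheta\otimes 1)^{(j)}\quad\text{if }\sigma_i\eta=\vartheta\sigma_j,\ \vartheta\in\Sigma_\alpha,\ \hat\vartheta\in\textstyle\prod_\alpha,\ \Pi(\hat\vartheta d)=\vartheta,$$ where $y^{(i)}$ denotes the element with entry $y$ in position $i$ and $0$ elsewhere. Then the map $$\varphi: k\Sigma_{l_1}\otimes_{k\prod_\alpha}k\Sigma_n\longrightarrow\bigoplus_{i=1}^s k\Sigma_{l_1}\otimes_{k\Sigma_\gamma}k,\qquad \tau\otimes\eta\longmapsto(\tau\hat\zeta\otimes 1)^{(i)}\quad\text{if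 }\eta=\zeta\sigma_i,\ \zeta=\Pi(\hat\zeta d),\ \hat\zeta\in\textstyle\prod_\alpha,$$ is well defined and an isomorphism of $(k\Sigma_{l_1},k\Sigma_n)$-bimodules. In particular $k\Sigma_{l_1}\otimes_{k\prod_\alpha}k\Sigma_n\cong\bigoplus_{i=1}^s M^\gamma$ as left $k\Sigma_{l_1}$-modules, where $M^\gamma$ is the permutation module on the $\gamma$-tabloids, and this left module has a finite filtration by submodules all of whose subquotients are dual Specht modules $S_\lambda=\mathrm{Hom}_k(S^\lambda,k)$ for partitions $\lambda$ of $l_1$. -/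

import Mathlib

open scoped TensorProduct MonoidAlgebra Pointwise RightActions

noncomputable section

/-! ### Diagrams -/

/-- A diagram with a top row of `a` dots and a bottom row of `b` dots: a set partition of the
dots, given as an equivalence relation (top dots are `Sum.inl x`, bottom dots are `Sum.inr y`). -/
abbrev Diagram (a b : ℕ) : Type := Setoid (Fin a ⊕ Fin b)

namespace Diagram

/-- Concatenation: write `x` on top of `y`, identify the bottom row of `x` with the top row of `y`,
follow the lines, and keep the top row of `x` and the bottom row of `y`. -/
abbrev concat {a b c : ℕ} (x : Diagram a b) (y : Diagram b c) : Diagram a c :=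
  Setoid.comap (Sum.map id Sum.inr : Fin a ⊕ Fin c → Fin a ⊕ (Fin b ⊕ Fin c))
    (Relation.EqvGen.setoid fun p q =>
      (∃ s t, x s t ∧ p = Sum.map id Sum.inl s ∧ q = Sum.map id Sum.inl t) ∨
      (∃ s t, y s t ∧ p = Sum.inr s ∧ q = Sum.inr t))

/-- The diagram of a permutation: the top dot `π i` is joined to the bottom dot `i`.
With this choice concatenation of diagrams is composition of permutations. -/
abbrev ofPerm {l : ℕ} (π : Equiv.Perm (Fin l)) : Diagram l l :=
  Setoid.ker (Sum.elim π.symm id)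

open Classical in
/-- The set of top dots that are joined to the bottom dot `j`. -/
def topDots {l n : ℕ} (d : Diagram l n) (j : Fin n) : Finset (Fin l) :=
  Finset.univ.filter fun x => d (Sum.inl x) (Sum.inr j)

/-- Number the parts of the top row of `d` that propagate by their leftmost dots, from left to
right.  The bottom dot `j` is sent to the number of the part of the top row it is joined to. -/
def propagate {l n : ℕ} (d : Diagram l n) (j : Fin n) : Fin n :=
  ⟨(Finset.univ.filter fun i => (d.topDots i).min < (d.topDots j).min).card, by
    calc _ < (Finset.univ : Finset (Fin n)).card :=
          Finset.card_lt_card ⟨Finset.filter_subset _ _, fun h => by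
            simpa using h (Finset.mem_univ j)⟩
      _ = n := by simp⟩

open Classical in
/-- The permutation `Π(d)` induced by the propagating lines of a diagram whose `n` bottom dots all
lie on different propagating parts (and the identity for other diagrams). -/
def perm {l n : ℕ} (d : Diagram l n) : Equiv.Perm (Fin n) :=
  if h : Function.Bijective d.propagate then Equiv.ofBijective _ h else 1

theorem concat_ofPerm {l n : ℕ} (π : Equiv.Perm (Fin l)) (d : Diagram l n)
    (s t : Fin l ⊕ Fin n) :
    concat (ofPerm π) d s t ↔ d (Sum.map π.symm id s) (Sum.map π.symm id t) := by
  let F : Fin l ⊕ (Fin l ⊕ Fin n) → Fin l ⊕ Fin n := Sum.elim (fun x => Sum.inl (π.symm x)) id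
  have hF : ∀ s : Fin l ⊕ Fin n, F (Sum.map id Sum.inr s) = Sum.map π.symm id s := by
    rintro (s | s) <;> rfl
  constructor
  · intro h
    have key : ∀ p q, Relation.EqvGen (fun p q =>
      (∃ s t, (ofPerm π) s t ∧ p = Sum.map id Sum.inl s ∧ q = Sum.map id Sum.inl t) ∨
      (∃ s t, d s t ∧ p = Sum.inr s ∧ q = Sum.inr t)) p q → d (F p) (F q) := by
      intro p q h
      induction h with
      | rel p q h =>
        rcases h with ⟨s, t, h, rfl, rfl⟩ | ⟨s, t, h, rfl, rfl⟩
        · have hs : ∀ s : Fin l ⊕ Fin l,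
              F (Sum.map id Sum.inl s) = Sum.inl (Sum.elim π.symm id s) := by
            rintro (s | s) <;> rfl
          rw [hs, hs]
          have h' : Sum.elim π.symm id s = Sum.elim π.symm id t := h
          rw [h']
        · exact h
      | refl p => exact d.refl _
      | symm p q _ ih => exact d.symm ih
      | trans p q r _ _ ih1 ih2 => exact d.trans ih1 ih2
    have := key _ _ h
    rwa [hF, hF] at this
  · intro h
    have key : ∀ s : Fin l ⊕ Fin n, Relation.EqvGen (fun p q =>
      (∃ s t, (ofPerm π) s t ∧ p = Sum.map id Sum.inl s ∧ q = Sum.map id Sum.inl t) ∨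
      (∃ s t, d s t ∧ p = Sum.inr s ∧ q = Sum.inr t)) (Sum.map id Sum.inr s)
        (Sum.inr (Sum.map π.symm id s)) := by
      rintro (s | s)
      · refine .rel _ _ (.inl ⟨.inl s, .inr (π.symm s), ?_, rfl, rfl⟩)
        change Sum.elim π.symm id (Sum.inl s) = Sum.elim π.symm id (Sum.inr (π.symm s))
        rfl
      · exact .refl _
    exact ((key s).trans _ _ _ (.rel _ _ (.inr ⟨_, _, h, rfl, rfl⟩))).trans _ _ _
      ((key t).symm _ _)

end Diagram

/-! ### Partial diagrams -/

/-- A partial diagram: one row of `l` dots, partitioned into parts, exactly `n` of which are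
labelled. -/
structure PartialDiagram (l n : ℕ) where
  /-- the set partition of the row of dots -/
  partition : Finpartition (Finset.univ : Finset (Fin l))
  /-- the labelled parts -/
  labelled : Finset (Finset (Fin l))
  labelled_subset : labelled ⊆ partition.parts
  card_labelled : labelled.card = n

namespace PartialDiagram

variable {l n : ℕ} (v : PartialDiagram l n)

theorem min_injOn : Set.InjOn (Finset.min : Finset (Fin l) → _) (v.labelled : Set _) := by
  intro p hp q hq h
  have hp' := v.labelled_subset hp
  have hq' := v.labelled_subset hq
  obtain ⟨a, ha⟩ := Finset.min_of_nonempty (v.partition.nonempty_of_mem_parts hp')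
  have hap := Finset.mem_of_min ha
  have haq := Finset.mem_of_min (h ▸ ha)
  exact v.partition.disjoint.elim_finset hp' hq' a hap haq

/-- A labelled part is determined by its leftmost dot. -/
def minEquiv : v.labelled ≃ v.labelled.image Finset.min :=
  Equiv.ofBijective (fun p => ⟨p.1.min, Finset.mem_image_of_mem _ p.2⟩) <| by
    constructor
    · intro p q h
      exact Subtype.ext (v.min_injOn p.2 q.2 (congrArg Subtype.val h))
    · rintro ⟨m, hm⟩
      obtain ⟨p, hp, rfl⟩ := Finset.mem_image.1 hm
      exact ⟨⟨p, hp⟩, rfl⟩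

/-- The numbering of the labelled parts from left to right according to their leftmost dots. -/
def numbering : Fin n ≃ v.labelled :=
  ((v.labelled.image Finset.min).orderIsoOfFin
    ((Finset.card_image_of_injOn v.min_injOn).trans v.card_labelled)).toEquiv.trans v.minEquiv.symm

/-- The `j`-th labelled part. -/
def labelledPart (j : Fin n) : Finset (Fin l) := (v.numbering j).1

theorem labelledPart_mem (j : Fin n) : v.labelledPart j ∈ v.labelled := (v.numbering j).2

theorem labelledPart_injective : Function.Injective v.labelledPart :=
  Subtype.val_injective.comp v.numbering.injective

theorem exists_labelledPart {p : Finset (Fin l)} (hp : p ∈ v.labelled) :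
    ∃ j, v.labelledPart j = p := by
  obtain ⟨j, hj⟩ := v.numbering.surjective ⟨p, hp⟩
  exact ⟨j, congrArg Subtype.val hj⟩

theorem min_labelledPart_lt_iff (i j : Fin n) :
    (v.labelledPart i).min < (v.labelledPart j).min ↔ i < j := by
  have h : ∀ i, (v.labelledPart i).min = ((v.labelled.image Finset.min).orderIsoOfFin
      ((Finset.card_image_of_injOn v.min_injOn).trans v.card_labelled) i).1 := by
    intro i
    have : v.minEquiv (v.numbering i) = (v.labelled.image Finset.min).orderIsoOfFin
      ((Finset.card_image_of_injOn v.min_injOn).trans v.card_labelled) i := by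
      simp [numbering]
    rw [← this]; rfl
  rw [h, h]
  exact (OrderIso.lt_iff_lt ((v.labelled.image Finset.min).orderIsoOfFin
      ((Finset.card_image_of_injOn v.min_injOn).trans v.card_labelled)) (x := i) (y := j))

/-- The diagram with top row `v` and `n` bottom dots, whose `j`-th bottom dot is joined to the
`j`-th labelled part of `v`: two dots are in the same part if and only if they lie on (top row) or
are joined to (bottom row) the same part of `v`. -/
abbrev diagram : Diagram l n :=
  Setoid.ker (Sum.elim v.partition.part v.labelledPart)

/-- The dots which lie on labelled parts; their number is `l₁`. -/
abbrev LabelledDot : Type := {x : Fin l // ∃ p ∈ v.labelled, x ∈ p}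

/-- A permutation of the labelled dots as an element of `Σ_l`, fixing the unlabelled dots. -/
def extend : Equiv.Perm v.LabelledDot →* Equiv.Perm (Fin l) := Equiv.Perm.ofSubtype

/-- The diagram `ζ d`, where `d = d_v`. -/
abbrev actDiagram (ζ : Equiv.Perm v.LabelledDot) : Diagram l n :=
  (Diagram.ofPerm (v.extend ζ)).concat v.diagram

/-- The stabilizer `∏_α` of the set of labelled parts. -/
def stabParts : Subgroup (Equiv.Perm v.LabelledDot) :=
  (MulAction.stabilizer (Equiv.Perm (Fin l)) v.labelled).comap v.extend

/-- The Young subgroup `Σ_γ`, the product of the symmetric groups on the single labelled parts. -/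
def youngParts : Subgroup (Equiv.Perm v.LabelledDot) :=
  ⨅ p ∈ v.labelled, (MulAction.stabilizer (Equiv.Perm (Fin l)) p).comap v.extend

/-- The Young subgroup `Σ_α` of `Σ_n`, the permutations of the labelled parts which preserve the
size of the parts. -/
def youngAlpha : Subgroup (Equiv.Perm (Fin n)) where
  carrier := {σ | ∀ j, (v.labelledPart (σ j)).card = (v.labelledPart j).card}
  mul_mem' := fun ha hb j => (ha _).trans (hb j)
  one_mem' := fun _ => rfl
  inv_mem' := fun {a} ha j => by
    have := ha (a⁻¹ j)
    rw [show a (a⁻¹ j) = j from a.apply_symm_apply j] at this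
    exact this.symm

theorem smul_mem_labelled {ζ : Equiv.Perm v.LabelledDot} (hζ : ζ ∈ v.stabParts)
    {p : Finset (Fin l)} (hp : p ∈ v.labelled) : v.extend ζ • p ∈ v.labelled := by
  have h : v.extend ζ • v.labelled = v.labelled := hζ
  rw [← h]
  exact Finset.smul_mem_smul_finset hp

theorem mem_youngParts {ζ : Equiv.Perm v.LabelledDot} :
    ζ ∈ v.youngParts ↔ ∀ p ∈ v.labelled, v.extend ζ • p = p := by
  simp [youngParts, Subgroup.mem_iInf, MulAction.mem_stabilizer_iff]

theorem topDots_actDiagram (ζ : Equiv.Perm v.LabelledDot) (j : Fin n) :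
    (v.actDiagram ζ).topDots j = v.extend ζ • v.labelledPart j := by
  classical
  ext x
  rw [Diagram.topDots, Finset.mem_filter, actDiagram, Diagram.concat_ofPerm,
    Finset.mem_smul_finset]
  change _ ∧ v.partition.part ((v.extend ζ).symm x) = v.labelledPart j ↔ _
  rw [Finpartition.part_eq_iff_mem _ (v.labelled_subset (v.labelledPart_mem j))]
  constructor
  · rintro ⟨-, h⟩
    exact ⟨_, h, (v.extend ζ).apply_symm_apply x⟩
  · rintro ⟨y, h, rfl⟩
    refine ⟨Finset.mem_univ _, ?_⟩
    rwa [Equiv.Perm.smul_def, Equiv.symm_apply_apply]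

theorem card_filter_perm_lt (τ : Equiv.Perm (Fin n)) (j : Fin n) :
    (Finset.univ.filter fun i => τ i < τ j).card = (τ j : ℕ) := by
  have : (Finset.univ.filter fun i => τ i < τ j).map τ.toEmbedding = Finset.Iio (τ j) := by
    ext x
    simp only [Finset.mem_map, Finset.mem_filter, Finset.mem_univ, true_and, Finset.mem_Iio,
      Equiv.coe_toEmbedding]
    exact ⟨by rintro ⟨y, h, rfl⟩; exact h, fun h => ⟨τ.symm x, by simpa using h, by simp⟩⟩
  rw [← Finset.card_map, this, Fin.card_Iio]

theorem exists_perm {ζ : Equiv.Perm v.LabelledDot} (hζ : ζ ∈ v.stabParts) :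
    ∃ τ : Equiv.Perm (Fin n), ∀ j, v.extend ζ • v.labelledPart j = v.labelledPart (τ j) := by
  choose f hf using fun j =>
    v.exists_labelledPart (v.smul_mem_labelled hζ (v.labelledPart_mem j))
  have hinj : Function.Injective f := by
    intro i j h
    apply v.labelledPart_injective
    have := (hf i).symm.trans ((congrArg _ h).trans (hf j))
    exact smul_left_cancel _ this
  exact ⟨Equiv.ofBijective f (Finite.injective_iff_bijective.1 hinj), fun j => (hf j).symm⟩

theorem perm_eq_of_smul {ζ : Equiv.Perm v.LabelledDot} {τ : Equiv.Perm (Fin n)}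
    (h : ∀ j, v.extend ζ • v.labelledPart j = v.labelledPart (τ j)) :
    (v.actDiagram ζ).perm = τ := by
  have hp : (v.actDiagram ζ).propagate = τ := by
    funext j
    apply Fin.ext
    simp only [Diagram.propagate, topDots_actDiagram, h, min_labelledPart_lt_iff]
    exact card_filter_perm_lt τ j
  rw [Diagram.perm, dif_pos (hp ▸ τ.bijective)]
  ext j
  simp [hp]

theorem smul_labelledPart {ζ : Equiv.Perm v.LabelledDot} (hζ : ζ ∈ v.stabParts) (j : Fin n) :
    v.extend ζ • v.labelledPart j = v.labelledPart ((v.actDiagram ζ).perm j) := by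
  obtain ⟨τ, h⟩ := v.exists_perm hζ
  rw [v.perm_eq_of_smul h]
  exact h j

/-- The group homomorphism `∏_α → Σ_n`, `ζ ↦ Π(ζ d)`. -/
def permHom : v.stabParts →* Equiv.Perm (Fin n) where
  toFun ζ := (v.actDiagram ζ).perm
  map_one' := v.perm_eq_of_smul fun j => by simp
  map_mul' ζ ξ := v.perm_eq_of_smul fun j => by
    rw [Subgroup.coe_mul, map_mul, mul_smul, v.smul_labelledPart ξ.2, v.smul_labelledPart ζ.2]
    rfl

theorem permHom_spec (ζ : v.stabParts) (j : Fin n) :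
    v.extend ζ • v.labelledPart j = v.labelledPart (v.permHom ζ j) :=
  v.smul_labelledPart ζ.2 j

theorem youngParts_le : v.youngParts ≤ v.stabParts := by
  intro ζ hζ
  rw [mem_youngParts] at hζ
  change v.extend ζ • v.labelled = v.labelled
  ext p
  rw [Finset.mem_smul_finset]
  constructor
  · rintro ⟨q, hq, rfl⟩
    rwa [hζ q hq]
  · intro hp
    exact ⟨p, hp, hζ p hp⟩

theorem permHom_eq_one_iff (ζ : v.stabParts) :
    v.permHom ζ = 1 ↔ (ζ : Equiv.Perm v.LabelledDot) ∈ v.youngParts := by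
  rw [mem_youngParts]
  constructor
  · intro h p hp
    obtain ⟨j, rfl⟩ := v.exists_labelledPart hp
    rw [permHom_spec, h]; rfl
  · intro h
    ext j
    have := v.permHom_spec ζ j
    rw [h _ (v.labelledPart_mem j)] at this
    rw [← v.labelledPart_injective this]; rfl

theorem permHom_mem (ζ : v.stabParts) : v.permHom ζ ∈ v.youngAlpha := fun j => by
  rw [← permHom_spec, Finset.card_smul_finset]

/-- Every labelled dot lies on exactly one labelled part. -/
def dotEquiv : v.LabelledDot ≃ Σ j : Fin n, v.labelledPart j :=
  (Equiv.ofBijective (fun y : Σ j : Fin n, v.labelledPart j =>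
    (⟨y.2.1, _, v.labelledPart_mem y.1, y.2.2⟩ : v.LabelledDot)) <| by
    constructor
    · rintro ⟨i, x, hx⟩ ⟨j, y, hy⟩ h
      have hxy : x = y := congrArg Subtype.val h
      subst hxy
      have hij : i = j := v.labelledPart_injective <| v.partition.disjoint.elim_finset
        (v.labelled_subset (v.labelledPart_mem i)) (v.labelled_subset (v.labelledPart_mem j))
        x hx hy
      subst hij
      rfl
    · rintro ⟨x, p, hp, hx⟩
      obtain ⟨j, rfl⟩ := v.exists_labelledPart hp
      exact ⟨⟨j, x, hx⟩, rfl⟩).symm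

theorem exists_lift {θ : Equiv.Perm (Fin n)} (hθ : θ ∈ v.youngAlpha) :
    ∃ ζ : v.stabParts, v.permHom ζ = θ := by
  let E : (Σ j : Fin n, v.labelledPart j) ≃ Σ j : Fin n, v.labelledPart j :=
    Equiv.sigmaCongr θ fun j => Finset.equivOfCardEq (hθ j).symm
  let ζ : Equiv.Perm v.LabelledDot := (v.dotEquiv.trans E).trans v.dotEquiv.symm
  have hmem : ∀ j, v.extend ζ • v.labelledPart j = v.labelledPart (θ j) := by
    intro j
    apply Finset.eq_of_subset_of_card_le
    · intro x hx
      obtain ⟨y, hy, rfl⟩ := Finset.mem_smul_finset.1 hx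
      have hyL : ∃ p ∈ v.labelled, y ∈ p := ⟨_, v.labelledPart_mem j, hy⟩
      rw [Equiv.Perm.smul_def, extend, Equiv.Perm.ofSubtype_apply_of_mem ζ hyL]
      have h1 : v.dotEquiv ⟨y, hyL⟩ = ⟨j, y, hy⟩ := by
        rw [dotEquiv, Equiv.symm_apply_eq]; rfl
      have h2 : ζ ⟨y, hyL⟩ = v.dotEquiv.symm (E ⟨j, y, hy⟩) := by
        simp only [ζ, Equiv.trans_apply, h1]
      rw [h2]
      exact (E ⟨j, y, hy⟩).2.2
    · rw [Finset.card_smul_finset, hθ j]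
  have hζ : ζ ∈ v.stabParts := by
    change v.extend ζ • v.labelled = v.labelled
    apply Finset.eq_of_subset_of_card_le
    · intro p hp
      obtain ⟨q, hq, rfl⟩ := Finset.mem_smul_finset.1 hp
      obtain ⟨j, rfl⟩ := v.exists_labelledPart hq
      rw [hmem]
      exact v.labelledPart_mem _
    · rw [Finset.card_smul_finset]
  exact ⟨⟨ζ, hζ⟩, v.perm_eq_of_smul hmem⟩

end PartialDiagram

/-! ### Tensor products over a subalgebra and bimodules -/

section Tensor

variable {k A R N : Type*} [CommRing k] [Ring A] [Algebra k A] [Ring R] [Algebra k R]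
  [AddCommGroup N] [Module k N]

/-- The relations `a r ⊗ y = a ⊗ r y` in `A ⊗_k N`.  They are stable under left multiplication
by `A`, so that their `A`-span is the additive group which they generate. -/
def tensorRel (f : R →ₐ[k] A) (g : R →ₐ[k] Module.End k N) : Submodule A (A ⊗[k] N) :=
  Submodule.span A {x | ∃ a r y, x = (a * f r) ⊗ₜ[k] y - a ⊗ₜ[k] (g r y)}

/-- The left `A`-module `A ⊗_R N`, for a `k`-algebra `A` which is a right `R`-module through
`f : R → A`, and a left `R`-module `N` with structure map `g`. -/
def TensorOver (f : R →ₐ[k] A) (g : R →ₐ[k] Module.End k N) : Type _ :=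
  (A ⊗[k] N) ⧸ tensorRel f g

namespace TensorOver

variable (f : R →ₐ[k] A) (g : R →ₐ[k] Module.End k N)

instance : AddCommGroup (TensorOver f g) :=
  inferInstanceAs (AddCommGroup ((A ⊗[k] N) ⧸ tensorRel f g))

instance : Module A (TensorOver f g) :=
  inferInstanceAs (Module A ((A ⊗[k] N) ⧸ tensorRel f g))

instance : Module k (TensorOver f g) :=
  inferInstanceAs (Module k ((A ⊗[k] N) ⧸ tensorRel f g))

instance : IsScalarTower k A (TensorOver f g) :=
  inferInstanceAs (IsScalarTower k A ((A ⊗[k] N) ⧸ tensorRel f g))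

/-- The quotient map `A ⊗_k N → A ⊗_R N`. -/
def mk : A ⊗[k] N →ₗ[A] TensorOver f g := (tensorRel f g).mkQ

/-- The class of `a ⊗ y` in `A ⊗_R N`. -/
def tmul (a : A) (y : N) : TensorOver f g := mk f g (a ⊗ₜ[k] y)

theorem mk_surjective : Function.Surjective (mk f g) := (tensorRel f g).mkQ_surjective

theorem smul_tmul (b a : A) (y : N) : b • tmul f g a y = tmul f g (b * a) y := by
  rw [tmul, tmul, ← map_smul, TensorProduct.smul_tmul', smul_eq_mul]

theorem mul_tmul (a : A) (r : R) (y : N) : tmul f g (a * f r) y = tmul f g a (g r y) := by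
  rw [tmul, tmul, ← sub_eq_zero, ← map_sub]
  exact (Submodule.Quotient.mk_eq_zero _).2 (Submodule.subset_span ⟨a, r, y, rfl⟩)

/-- The map `y ↦ a ⊗ y`. -/
def tmulLin (a : A) : N →ₗ[k] TensorOver f g :=
  ((mk f g).restrictScalars k).comp (TensorProduct.mk k A N a)

theorem tmulLin_apply (a : A) (y : N) : tmulLin f g a y = tmul f g a y := rfl

theorem tmul_eq_smul (a : A) (y : N) : tmul f g a y = a • tmul f g 1 y := by
  rw [smul_tmul, mul_one]

variable {f g}

/-- Two `A`-linear maps out of `A ⊗_R N` agree if they agree on all `1 ⊗ y`. -/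
theorem hom_ext {P : Type*} [AddCommGroup P] [Module A P] {h h' : TensorOver f g →ₗ[A] P}
    (H : ∀ y, h (tmul f g 1 y) = h' (tmul f g 1 y)) : h = h' := by
  have : ∀ x, h (mk f g x) = h' (mk f g x) := by
    intro x
    induction x using TensorProduct.induction_on with
    | zero => simp
    | add x y hx hy => rw [map_add, map_add, map_add, hx, hy]
    | tmul a y =>
      change h (tmul f g a y) = h' (tmul f g a y)
      rw [tmul_eq_smul, map_smul, map_smul, H]
  ext x
  obtain ⟨x, rfl⟩ := mk_surjective f g x
  exact this x

/-- The `A`-linear map out of `A ⊗_R N`, `a ⊗ y ↦ a (q y)`, for an `R`-linear map `q`. -/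
def lift {P : Type*} [AddCommGroup P] [Module k P] [Module A P] [IsScalarTower k A P]
    (q : N →ₗ[k] P) (hq : ∀ r y, q (g r y) = f r • q y) : TensorOver f g →ₗ[A] P :=
  (tensorRel f g).liftQ (TensorProduct.AlgebraTensorModule.lift
    ((LinearMap.toSpanSingleton A (N →ₗ[k] P) q))) <| by
    rw [tensorRel, Submodule.span_le]
    rintro _ ⟨a, r, y, rfl⟩
    rw [SetLike.mem_coe, LinearMap.mem_ker, map_sub]
    simp [hq, mul_smul]

theorem lift_tmul {P : Type*} [AddCommGroup P] [Module k P] [Module A P] [IsScalarTower k A P]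
    (q : N →ₗ[k] P) (hq : ∀ r y, q (g r y) = f r • q y) (a : A) (y : N) :
    lift (f := f) (g := g) q hq (tmul f g a y) = a • q y := by
  change TensorProduct.AlgebraTensorModule.lift
    ((LinearMap.toSpanSingleton A (N →ₗ[k] P) q)) (a ⊗ₜ[k] y) = a • q y
  simp

end TensorOver

end Tensor

/-! ### The tensor product over the stabilizer and the tensor induced module -/

/-- Representatives `σ_1, …, σ_s` of the right cosets `H g` of a subgroup `H` in `G`. -/
structure CosetReps {G : Type*} [Group G] (H : Subgroup G) (s : ℕ) where
  /-- the `i`-th representative -/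
  rep : Fin s → G
  existsUnique : ∀ g : G, ∃! i : Fin s, g * (rep i)⁻¹ ∈ H

/-- The index `i` of the coset `H σ_i` of `g`. -/
def CosetReps.idx {G : Type*} [Group G] {H : Subgroup G} {s : ℕ} (σ : CosetReps H s) (g : G) :
    Fin s := (σ.existsUnique g).choose

theorem CosetReps.idx_mem {G : Type*} [Group G] {H : Subgroup G} {s : ℕ} (σ : CosetReps H s)
    (g : G) : g * (σ.rep (σ.idx g))⁻¹ ∈ H := (σ.existsUnique g).choose_spec.1

theorem CosetReps.idx_eq {G : Type*} [Group G] {H : Subgroup G} {s : ℕ} (σ : CosetReps H s)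
    {g h : G} {i : Fin s} (hh : h ∈ H) (hg : g = h * σ.rep i) : σ.idx g = i :=
  ((σ.existsUnique g).choose_spec.2 i (by subst hg; simpa using hh)).symm

namespace PartialDiagram

variable (k : Type*) [CommRing k] {l n : ℕ} (v : PartialDiagram l n)

/-- The action of `k ∏_α` on `k Σ_n`, given by `ζ · η = Π(ζ d) η`. -/
def stabAction : k[v.stabParts] →ₐ[k] Module.End k k[Equiv.Perm (Fin n)] :=
  (Algebra.lmul k k[Equiv.Perm (Fin n)]).comp (MonoidAlgebra.mapDomainAlgHom k k v.permHom)

/-- The bimodule `k Σ_{l₁} ⊗_{k ∏_α} k Σ_n`. -/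
abbrev TensorBimodule : Type _ :=
  TensorOver (MonoidAlgebra.mapDomainAlgHom k k v.stabParts.subtype) (v.stabAction k)

/-- Right multiplication by `b ∈ k Σ_n`, `τ ⊗ η ↦ τ ⊗ η b`. -/
def TensorBimodule.mulRight (b : k[Equiv.Perm (Fin n)]) :
    TensorBimodule k v →ₗ[k[Equiv.Perm v.LabelledDot]] TensorBimodule k v :=
  TensorOver.lift ((TensorOver.tmulLin _ _ 1).comp (LinearMap.mulRight k b)) fun r y => by
    rw [LinearMap.comp_apply, LinearMap.comp_apply, TensorOver.tmulLin_apply,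
      TensorOver.tmulLin_apply, TensorOver.smul_tmul, mul_one]
    conv_rhs => rw [← one_mul (MonoidAlgebra.mapDomainAlgHom k k v.stabParts.subtype r)]
    rw [TensorOver.mul_tmul]
    exact congrArg (TensorOver.tmul _ _ 1) (mul_assoc _ y b)

theorem TensorBimodule.mulRight_tmul (b : k[Equiv.Perm (Fin n)])
    (a : k[Equiv.Perm v.LabelledDot]) (y : k[Equiv.Perm (Fin n)]) :
    TensorBimodule.mulRight k v b (TensorOver.tmul _ _ a y) = TensorOver.tmul _ _ a (y * b) := by
  rw [mulRight, TensorOver.lift_tmul, LinearMap.comp_apply, TensorOver.tmulLin_apply,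
    ← TensorOver.tmul_eq_smul]
  rfl

theorem TensorBimodule.tmul_add (a : k[Equiv.Perm v.LabelledDot])
    (y z : k[Equiv.Perm (Fin n)]) :
    (TensorOver.tmul _ _ a (y + z) : TensorBimodule k v) =
      TensorOver.tmul _ _ a y + TensorOver.tmul _ _ a z :=
  map_add (TensorOver.tmulLin _ _ a) y z

/-- The right action of `k Σ_n` on `k Σ_{l₁} ⊗_{k ∏_α} k Σ_n`. -/
def TensorBimodule.rightAction :
    k[Equiv.Perm (Fin n)]ᵐᵒᵖ →+* Module.End k[Equiv.Perm v.LabelledDot] (TensorBimodule k v) where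
  toFun b := TensorBimodule.mulRight k v b.unop
  map_one' := TensorOver.hom_ext fun y => by
    rw [mulRight_tmul]; simp
  map_mul' b c := TensorOver.hom_ext fun y => by
    rw [Module.End.mul_apply, mulRight_tmul, mulRight_tmul, mulRight_tmul, MulOpposite.unop_mul,
      mul_assoc]
  map_zero' := TensorOver.hom_ext fun y => by
    rw [mulRight_tmul, MulOpposite.unop_zero, mul_zero]
    exact map_zero (TensorOver.tmulLin _ _ _)
  map_add' b c := TensorOver.hom_ext fun y => by
    rw [LinearMap.add_apply, mulRight_tmul, mulRight_tmul, mulRight_tmul, MulOpposite.unop_add,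
      mul_add, tmul_add]

instance : Module k[Equiv.Perm (Fin n)]ᵐᵒᵖ (TensorBimodule k v) :=
  Module.compHom _ (TensorBimodule.rightAction k v)

theorem TensorBimodule.tmul_smul (a : k[Equiv.Perm v.LabelledDot])
    (y b : k[Equiv.Perm (Fin n)]) :
    (TensorOver.tmul _ _ a y : TensorBimodule k v) <• b = TensorOver.tmul _ _ a (y * b) :=
  TensorBimodule.mulRight_tmul k v b a y

/-- The left and right actions commute. -/
instance : SMulCommClass k[Equiv.Perm v.LabelledDot] k[Equiv.Perm (Fin n)]ᵐᵒᵖ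
    (TensorBimodule k v) where
  smul_comm a b x := ((TensorBimodule.rightAction k v b).map_smul a x).symm

/-- The left module `k Σ_{l₁} ⊗_{k Σ_γ} k`, with `Σ_γ` acting trivially on `k`. -/
abbrev Induced : Type _ :=
  TensorOver (MonoidAlgebra.mapDomainAlgHom k k v.youngParts.subtype)
    (Representation.trivial k v.youngParts k).asAlgebraHom

variable {k}

/-- The element `τ ⊗ 1` of `k Σ_{l₁} ⊗_{k Σ_γ} k`. -/
def Induced.of (τ : Equiv.Perm v.LabelledDot) : Induced k v :=
  TensorOver.tmul _ _ (MonoidAlgebra.single τ 1) 1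

theorem Induced.hom_ext {P : Type*} [AddCommGroup P] [Module k P]
    [Module k[Equiv.Perm v.LabelledDot] P] [IsScalarTower k k[Equiv.Perm v.LabelledDot] P]
    {h h' : Induced k v →ₗ[k[Equiv.Perm v.LabelledDot]] P}
    (H : h (Induced.of v 1) = h' (Induced.of v 1)) : h = h' := TensorOver.hom_ext fun c => by
  have e : (TensorOver.tmul _ _ 1 c : Induced k v) = c • Induced.of v 1 := by
    rw [Induced.of]
    have := map_smul (TensorOver.tmulLin (MonoidAlgebra.mapDomainAlgHom k k v.youngParts.subtype)
      (Representation.trivial k v.youngParts k).asAlgebraHom (1 : k[Equiv.Perm v.LabelledDot])) c 1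
    rw [smul_eq_mul, mul_one] at this
    exact this
  rw [e, LinearMap.map_smul_of_tower, LinearMap.map_smul_of_tower, H]

theorem Induced.of_mul_young (τ : Equiv.Perm v.LabelledDot) {ζ : Equiv.Perm v.LabelledDot}
    (hζ : ζ ∈ v.youngParts) : (Induced.of v (τ * ζ) : Induced k v) = Induced.of v τ := by
  have := TensorOver.mul_tmul (MonoidAlgebra.mapDomainAlgHom k k v.youngParts.subtype)
      (Representation.trivial k v.youngParts k).asAlgebraHom
      (MonoidAlgebra.single τ 1) (MonoidAlgebra.single ⟨ζ, hζ⟩ 1) 1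
  simpa [Induced.of, MonoidAlgebra.single_mul_single] using this

/-- For `ζ ∈ ∏_α`, the map `τ ⊗ 1 ↦ τ ζ ⊗ 1` of `k Σ_{l₁} ⊗_{k Σ_γ} k`. -/
def Induced.mulRight (ζ : v.stabParts) :
    Induced k v →ₗ[k[Equiv.Perm v.LabelledDot]] Induced k v :=
  TensorOver.lift (TensorOver.tmulLin _ _ (MonoidAlgebra.single (ζ : Equiv.Perm _) 1))
    fun r c => by
    rw [TensorOver.tmulLin_apply, TensorOver.tmulLin_apply, TensorOver.smul_tmul]
    induction r using MonoidAlgebra.induction_linear with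
    | zero =>
      rw [map_zero, map_zero, zero_mul, LinearMap.zero_apply]
      rw [TensorOver.tmul, TensorOver.tmul, TensorProduct.zero_tmul, TensorProduct.tmul_zero]
    | add r r' h h' =>
      rw [map_add, map_add, add_mul, LinearMap.add_apply]
      rw [TensorOver.tmul, TensorOver.tmul, TensorProduct.add_tmul, TensorProduct.tmul_add,
        map_add, map_add]
      exact congrArg₂ _ h h'
    | single g c' =>
      have hg : (ζ : Equiv.Perm v.LabelledDot)⁻¹ * g * ζ ∈ v.youngParts := by
        have h1 : v.permHom ⟨g, v.youngParts_le g.2⟩ = 1 := (v.permHom_eq_one_iff _).2 g.2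
        have h2 : v.permHom (ζ⁻¹ * ⟨g, v.youngParts_le g.2⟩ * ζ) = 1 := by
          rw [map_mul, map_mul, h1, mul_one, map_inv, inv_mul_cancel]
        exact (v.permHom_eq_one_iff _).1 h2
      have := TensorOver.mul_tmul (MonoidAlgebra.mapDomainAlgHom k k v.youngParts.subtype)
        (Representation.trivial k v.youngParts k).asAlgebraHom
        (MonoidAlgebra.single (ζ : Equiv.Perm _) 1) (MonoidAlgebra.single ⟨_, hg⟩ c') c
      simp only [MonoidAlgebra.mapDomainAlgHom_apply, MonoidAlgebra.mapDomain_single,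
        MonoidAlgebra.single_mul_single, Subgroup.coe_subtype, one_mul, mul_one,
        Representation.asAlgebraHom_single, Representation.isTrivial_def] at this ⊢
      rw [← this]
      congr 2
      group

theorem Induced.mulRight_of (ζ : v.stabParts) (τ : Equiv.Perm v.LabelledDot) :
    Induced.mulRight v ζ (Induced.of v τ : Induced k v) = Induced.of v (τ * ζ) := by
  rw [Induced.mulRight, Induced.of, TensorOver.lift_tmul, TensorOver.tmulLin_apply,
    TensorOver.smul_tmul, MonoidAlgebra.single_mul_single, mul_one, Induced.of]

theorem Induced.mulRight_congr {ζ ξ : v.stabParts} (h : v.permHom ζ = v.permHom ξ) :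
    (Induced.mulRight v ζ : Induced k v →ₗ[_] Induced k v) = Induced.mulRight v ξ := by
  apply Induced.hom_ext
  rw [mulRight_of, mulRight_of, one_mul, one_mul]
  have h1 : ((ξ⁻¹ * ζ : v.stabParts) : Equiv.Perm v.LabelledDot) ∈ v.youngParts := by
    rw [← permHom_eq_one_iff, map_mul, map_inv, h, inv_mul_cancel]
  rw [← Induced.of_mul_young v ξ h1]
  simp

theorem Induced.mulRight_mul (ζ ξ : v.stabParts) (x : Induced k v) :
    Induced.mulRight v (ζ * ξ) x = Induced.mulRight v ξ (Induced.mulRight v ζ x) := by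
  have : (Induced.mulRight v (ζ * ξ) : Induced k v →ₗ[_] Induced k v) =
      (Induced.mulRight v ξ).comp (Induced.mulRight v ζ) := by
    apply Induced.hom_ext
    rw [LinearMap.comp_apply, mulRight_of, mulRight_of, mulRight_of, Subgroup.coe_mul, mul_assoc]
  rw [this]; rfl

variable (k) {v} {s : ℕ} (σ : CosetReps v.youngAlpha s)

/-- The tensor induced module `⨁_{i=1}^s k Σ_{l₁} ⊗_{k Σ_γ} k`, whose right `k Σ_n`-module structure
depends on the representatives `σ_1, …, σ_s` of `Σ_α \ Σ_n`. -/
def TensorInduced (_ : CosetReps v.youngAlpha s) : Type _ := Fin s → Induced k v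

namespace TensorInduced

instance : AddCommGroup (TensorInduced k σ) := inferInstanceAs (AddCommGroup (Fin s → Induced k v))

instance : Module k[Equiv.Perm v.LabelledDot] (TensorInduced k σ) :=
  inferInstanceAs (Module k[Equiv.Perm v.LabelledDot] (Fin s → Induced k v))

instance : Module k (TensorInduced k σ) := inferInstanceAs (Module k (Fin s → Induced k v))

instance : IsScalarTower k k[Equiv.Perm v.LabelledDot] (TensorInduced k σ) :=
  inferInstanceAs (IsScalarTower k k[Equiv.Perm v.LabelledDot] (Fin s → Induced k v))

/-- The element `y^{(i)} = (0, …, 0, y, 0, …, 0)`. -/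
def single (i : Fin s) : Induced k v →ₗ[k[Equiv.Perm v.LabelledDot]] TensorInduced k σ :=
  LinearMap.single _ (fun _ : Fin s => Induced k v) i

variable {k σ} in
theorem hom_ext {P : Type*} [AddCommGroup P] [Module k[Equiv.Perm v.LabelledDot] P]
    {h h' : TensorInduced k σ →ₗ[k[Equiv.Perm v.LabelledDot]] P}
    (H : ∀ i y, h (single k σ i y) = h' (single k σ i y)) : h = h' :=
  LinearMap.pi_ext H

/-- An element `ϑ̂ ∈ ∏_α` with `Π(ϑ̂ d) = ϑ`, where `η = ϑ σ_j`. -/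
def hat (η : Equiv.Perm (Fin n)) : v.stabParts := (v.exists_lift (σ.idx_mem η)).choose

theorem permHom_hat (η : Equiv.Perm (Fin n)) :
    v.permHom (hat σ η) = η * (σ.rep (σ.idx η))⁻¹ := (v.exists_lift (σ.idx_mem η)).choose_spec

/-- The right action of `η ∈ Σ_n`: `(τ ⊗ 1)^{(i)} η = (τ ϑ̂ ⊗ 1)^{(j)}`, where `σ_i η = ϑ σ_j`
and `ϑ = Π(ϑ̂ d)`. -/
def act (η : Equiv.Perm (Fin n)) :
    TensorInduced k σ →ₗ[k[Equiv.Perm v.LabelledDot]] TensorInduced k σ :=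
  LinearMap.lsum _ (fun _ : Fin s => Induced k v) ℕ fun i =>
    (single k σ (σ.idx (σ.rep i * η))).comp (Induced.mulRight v (hat σ (σ.rep i * η)))

theorem act_single (η : Equiv.Perm (Fin n)) (i j : Fin s) (ξ : v.stabParts)
    (h : σ.rep i * η = v.permHom ξ * σ.rep j) (y : Induced k v) :
    act k σ η (single k σ i y) = single k σ j (Induced.mulRight v ξ y) := by
  have e : act k σ η (single k σ i y) = single k σ (σ.idx (σ.rep i * η))
      (Induced.mulRight v (hat σ (σ.rep i * η)) y) :=
    LinearMap.lsum_piSingle _ _ _ _ _ _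
  have hj : σ.idx (σ.rep i * η) = j := σ.idx_eq (v.permHom_mem ξ) h
  have hh : v.permHom (hat σ (σ.rep i * η)) = v.permHom ξ := by
    rw [permHom_hat, hj, h, mul_inv_cancel_right]
  rw [e, hj, Induced.mulRight_congr v hh]

/-- The right action of the group `Σ_n`. -/
def actHom : Equiv.Perm (Fin n) →*
    (Module.End k[Equiv.Perm v.LabelledDot] (TensorInduced k σ))ᵐᵒᵖ where
  toFun η := MulOpposite.op (act k σ η)
  map_one' := by
    rw [← MulOpposite.op_one]
    congr 1
    apply hom_ext
    intro i y
    rw [act_single k σ 1 i i 1 (by simp)]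
    have : (Induced.mulRight v 1 : Induced k v →ₗ[_] Induced k v) = LinearMap.id :=
      Induced.hom_ext v (by rw [Induced.mulRight_of]; simp)
    rw [this]; rfl
  map_mul' η η' := by
    rw [← MulOpposite.op_mul]
    congr 1
    apply hom_ext
    intro i y
    obtain ⟨j, ξ, h⟩ : ∃ j ξ, σ.rep i * η = v.permHom ξ * σ.rep j :=
      ⟨_, hat σ (σ.rep i * η), by rw [permHom_hat, inv_mul_cancel_right]⟩
    obtain ⟨m, ξ', h'⟩ : ∃ m ξ', σ.rep j * η' = v.permHom ξ' * σ.rep m :=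
      ⟨_, hat σ (σ.rep j * η'), by rw [permHom_hat, inv_mul_cancel_right]⟩
    rw [Module.End.mul_apply, act_single k σ η i j ξ h, act_single k σ η' j m ξ' h',
      act_single k σ (η * η') i m (ξ * ξ') ?_, Induced.mulRight_mul]
    rw [map_mul, mul_assoc, ← h', ← mul_assoc, ← mul_assoc, h]

/-- The right action of `k Σ_n`, extended linearly from `Σ_n`. -/
instance : Module k[Equiv.Perm (Fin n)]ᵐᵒᵖ (TensorInduced k σ) :=
  Module.compHom _ (AlgHom.opComm (MonoidAlgebra.lift k _ _ (actHom k σ))).toRingHom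

/-- The formula which defines the right module structure; it holds for every choice of `ϑ̂`. -/
theorem single_of_smul (τ : Equiv.Perm v.LabelledDot) (η : Equiv.Perm (Fin n)) (i j : Fin s)
    (ξ : v.stabParts) (h : σ.rep i * η = (v.actDiagram ξ).perm * σ.rep j) :
    single k σ i (Induced.of v τ) <• (MonoidAlgebra.single η 1 : k[Equiv.Perm (Fin n)]) =
      single k σ j (Induced.of v (τ * ξ)) := by
  have h1 : single k σ i (Induced.of v τ) <• (MonoidAlgebra.single η 1 : k[Equiv.Perm (Fin n)]) =
      act k σ η (single k σ i (Induced.of v τ)) := by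
    change MulOpposite.unop (MonoidAlgebra.lift k _ _ (actHom k σ) (MonoidAlgebra.single η 1)) _ = _
    rw [MonoidAlgebra.lift_single, one_smul]
    rfl
  rw [h1, act_single k σ η i j ξ h, Induced.mulRight_of]

/-- The left and right actions commute. -/
instance : SMulCommClass k[Equiv.Perm v.LabelledDot] k[Equiv.Perm (Fin n)]ᵐᵒᵖ
    (TensorInduced k σ) where
  smul_comm a b x := (((AlgHom.opComm (MonoidAlgebra.lift k _ _ (actHom k σ))) b).map_smul a x).symm

end TensorInduced

end PartialDiagram

/-! ### Permutation modules, Specht modules and dual Specht filtrations -/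

section Specht

/-- Tabloids with entries in `X` whose `j`-th row has `c j` entries: `t x` is the row of `x`. -/
def Tabloid (X : Type*) [Fintype X] (c : ℕ → ℕ) : Type _ :=
  {t : X → ℕ // ∀ j, (Finset.univ.filter fun x => t x = j).card = c j}

instance {X : Type*} [Fintype X] {c : ℕ → ℕ} : MulAction (Equiv.Perm X) (Tabloid X c) where
  smul π t := ⟨fun x => t.1 (π⁻¹ x), fun j => by
    rw [← t.2 j]
    apply Finset.card_bij' (fun x _ => π⁻¹ x) (fun x _ => π x) <;> simp⟩
  one_smul _ := rfl
  mul_smul _ _ _ := rfl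

variable (k : Type*) [CommRing k] (X : Type*) [Fintype X] [DecidableEq X]

/-- The permutation module of `Σ_X` on the tabloids with row lengths `c`. -/
abbrev tabloidRep (c : ℕ → ℕ) : Representation k (Equiv.Perm X) k[Tabloid X c] :=
  Representation.ofMulAction k (Equiv.Perm X) (Tabloid X c)

/-- The permutation module `M^c`, as a module over the group algebra. -/
abbrev PermutationModule (c : ℕ → ℕ) : Type _ := (tabloidRep k X c).asModule

variable {X}

/-- The tabloid of a tableau of shape `μ` (a bijective filling of the cells with entries in `X`;
the cell `(i, j)` lies in row `i` and column `j`). -/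
def tabloidOf {μ : YoungDiagram} (T : μ.cells ≃ X) : Tabloid X μ.rowLen :=
  ⟨fun x => (T.symm x).1.1, fun i => by
    rw [μ.rowLen_eq_card]
    refine Finset.card_bij' (fun x _ => (T.symm x).1)
      (fun c hc => T ⟨c, (YoungDiagram.mem_row_iff.1 hc).1⟩) ?_ ?_ ?_ ?_
    · intro x hx
      rw [YoungDiagram.mem_row_iff]
      exact ⟨(T.symm x).2, by simpa using hx⟩
    · intro c hc
      rw [YoungDiagram.mem_row_iff] at hc
      simpa using hc.2
    · intro x hx; simp
    · intro c hc; simp⟩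

/-- The column stabilizer of a tableau. -/
def colStab {μ : YoungDiagram} (T : μ.cells ≃ X) : Finset (Equiv.Perm X) :=
  Finset.univ.filter fun π => ∀ x, (T.symm (π x)).1.2 = (T.symm x).1.2

/-- The polytabloid `e_T`, the signed sum of the tabloids `π {T}` over the column stabilizer. -/
def polytabloid {μ : YoungDiagram} (T : μ.cells ≃ X) : k[Tabloid X μ.rowLen] :=
  ∑ π ∈ colStab T, MonoidAlgebra.single (π • tabloidOf T) ((Equiv.Perm.sign π : ℤ) : k)

theorem tabloidRep_polytabloid {μ : YoungDiagram} (T : μ.cells ≃ X) (ρ : Equiv.Perm X) :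
    tabloidRep k X _ ρ (polytabloid k T) = polytabloid k (T.trans ρ) := by
  rw [polytabloid, polytabloid, map_sum]
  apply Finset.sum_bij' (fun π _ => ρ * π * ρ⁻¹) (fun π _ => ρ⁻¹ * π * ρ)
  · intro π hπ
    simp only [colStab, Finset.mem_filter, Finset.mem_univ, true_and] at hπ ⊢
    intro x
    have := hπ (ρ.symm x)
    simpa [Equiv.Perm.mul_apply] using this
  · intro π hπ
    simp only [colStab, Finset.mem_filter, Finset.mem_univ, true_and] at hπ ⊢
    intro x
    have := hπ (ρ x)
    simpa [Equiv.Perm.mul_apply] using this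
  · intro π _; group
  · intro π _; group
  · intro π _
    have h : tabloidOf (T.trans ρ) = ρ • tabloidOf T := rfl
    rw [Representation.ofMulAction_single, h, smul_smul, smul_smul]
    congr 1
    · group
    · have h2 : Equiv.Perm.sign (ρ * π * ρ⁻¹) = Equiv.Perm.sign π := by
        rw [map_mul, map_mul, map_inv, mul_right_comm, mul_inv_cancel, one_mul]
      rw [h2]

variable (X)

/-- The Specht module `S^μ`, the submodule of `M^μ` spanned by the polytabloids. -/
def specht (μ : YoungDiagram) : Subrepresentation (tabloidRep k X μ.rowLen) where
  toSubmodule := Submodule.span k (Set.range fun T : μ.cells ≃ X => polytabloid k T)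
  apply_mem_toSubmodule ρ v hv := by
    induction hv using Submodule.span_induction with
    | mem x hx =>
      obtain ⟨T, rfl⟩ := hx
      exact Submodule.subset_span ⟨T.trans ρ, (tabloidRep_polytabloid k T ρ).symm⟩
    | zero => rw [map_zero]; exact Submodule.zero_mem _
    | add x y _ _ hx hy => rw [map_add]; exact Submodule.add_mem _ hx hy
    | smul c x _ hx => rw [map_smul]; exact Submodule.smul_mem _ _ hx

/-- The dual Specht module `S_μ`, the contragredient dual of the Specht module `S^μ`. -/
abbrev DualSpecht (μ : YoungDiagram) : Type _ := (specht k X μ).toRepresentation.dual.asModule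

/-- `M` has a finite filtration by submodules whose subquotients are dual Specht modules `S_μ`,
for partitions `μ` of the size of `X`. -/
def DualSpechtFiltered (M : Type*) [AddCommGroup M] [Module k[Equiv.Perm X] M] : Prop :=
  ∃ (m : ℕ) (F : Fin (m + 1) → Submodule k[Equiv.Perm X] M),
    F 0 = ⊥ ∧ F (Fin.last m) = ⊤ ∧ ∀ i : Fin m, F i.castSucc ≤ F i.succ ∧
      ∃ μ : YoungDiagram, μ.card = Fintype.card X ∧
        Nonempty ((F i.succ ⧸ (F i.castSucc).submoduleOf (F i.succ)) ≃ₗ[k[Equiv.Perm X]]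
          DualSpecht k X μ)

end Specht

namespace PartialDiagram

variable {l n : ℕ} (v : PartialDiagram l n)

/-- The number `α_i` of labelled parts of size `i`. -/
def alpha (i : ℕ) : ℕ := (v.labelled.filter fun p => p.card = i).card

/-- The composition `γ = (1^{α_1}, 2^{α_2}, …)`, as a list. -/
def gammaList : List ℕ := (List.range (l + 1)).flatMap fun i => List.replicate (v.alpha i) i

/-- The row lengths given by `γ`. -/
def gamma (j : ℕ) : ℕ := v.gammaList.getD j 0

end PartialDiagram

end

/-! Bimodule isomorphism. The map `Π` sends `∏_α` onto `Σ_α` with kernel `Σ_γ`, and `kΣ_n` is the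
direct sum of the free left `kΣ_α`-modules `kΣ_α σ_i`. Tensoring over `k∏_α` therefore turns each
summand into `kΣ_{l₁} ⊗_{kΣ_γ} k`. This is `equivTensor`, with inverse `(τ ⊗ 1)^{(i)} ↦ τ ⊗ σ_i`;
`equivTensor_smul` compares the right actions. Some `γ`-tabloid has stabilizer `Σ_γ`, so each
summand is `M^γ` (`nonempty_induced_equiv`).

Filtration of `M^c`. A column-strict filling `B` of shape `μ` and content `c` gives a homomorphism
`θ_B : M^μ → M^c` (`permutationModuleHom`) and a map `ψ_B` on `M^c` formed from signed column sums
(`colForm`). A rearrangement inequality in the columns makes these triangular for `rowWeight`: `ψ_C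
θ_B = 0` when `B` weighs at most as much as `C` and their rows have different contents
(`colForm_tabloidHom_eq_zero`), while `ψ_B θ_B` is the pairing with the polytabloids
(`colForm_tabloidHom_self`), whose kernel dies in `S_μ`. Adding the images of the `θ_B` in order of
weight gives a chain whose subquotients map onto the `S_μ`. If `dim M^c ≤ ∑ dim S_μ`, all these maps
are bijective and the chain ends at `M^c` (`exists_filtration_of_triangular`).

The dimension bound is one half of the Robinson-Schensted-Knuth correspondence, obtained from growth
diagrams. A tabloid is a word, hence a 0-1 matrix; the two outer edges of its growth diagram are a
filling of content `c` and a standard tableau, and they determine the matrix (`growth_inj`,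
`exists_fillings`). The tableaux that share a filling have independent polytabloids, so they bound
`dim S_μ` from below. It is never needed that every pair arises, nor that standard polytabloids
span, and the characteristic plays no role. -/

noncomputable section

/-! ### Growth diagrams -/

/-- `α / μ` is a horizontal strip, for partitions given by their row lengths. -/
def IsStrip (μ α : ℕ → ℕ) : Prop := ∀ r, μ r ≤ α r ∧ α (r + 1) ≤ μ r

/-- Fomin's local rule for the fourth corner of a square of a growth diagram. -/
def localRule (μ α β : ℕ → ℕ) (m : ℕ) : ℕ → ℕ
  | 0 => max (α 0) (β 0) + m
  | r + 1 => max (α (r + 1)) (β (r + 1)) + min (α r) (β r) - μ r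

/-- Since `μ r` is at most `α r` and `β r`, the subtraction in the rule is never truncated. -/
theorem localRule_add {μ α β : ℕ → ℕ} (hα : IsStrip μ α) (hβ : IsStrip μ β) (m r : ℕ) :
    localRule μ α β m (r + 1) + μ r = max (α (r + 1)) (β (r + 1)) + min (α r) (β r) := by
  have := hα r
  have := hβ r
  simp only [localRule]
  omega

/-- From `α (r + 1), β (r + 1) ≤ μ r`, row `r + 1` of the new corner is at most `min (α r) (β r)`;
from `μ r ≤ α r, β r`, each of its rows is at least the maximum of the rows of `α` and `β`. -/
theorem localRule_strip {μ α β : ℕ → ℕ} (hα : IsStrip μ α) (hβ : IsStrip μ β) (m : ℕ) :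
    IsStrip α (localRule μ α β m) ∧ IsStrip β (localRule μ α β m) := by
  constructor <;> intro r <;>
  · have h1 := localRule_add hα hβ m r
    have h2 := hα r
    have h3 := hβ r
    refine ⟨?_, by omega⟩
    rcases r with _ | r
    · simp only [localRule]; omega
    · have h1 := localRule_add hα hβ m r
      have h2 := hα r
      have h3 := hβ r
      omega

theorem sum_localRule {μ α β : ℕ → ℕ} (hα : IsStrip μ α) (hβ : IsStrip μ β) (m K : ℕ)
    (hαK : α K = 0) (hβK : β K = 0) :
    ∑ r ∈ Finset.range (K + 1), localRule μ α β m r + ∑ r ∈ Finset.range (K + 1), μ r =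
      ∑ r ∈ Finset.range (K + 1), α r + ∑ r ∈ Finset.range (K + 1), β r + m := by
  have hμK : μ K = 0 := by have := (hα K).1; omega
  -- Since `max + min` is the sum, the rule telescopes; the boundary term `max (α K) (β K)` vanishes
  -- for the given `K`.
  have h : ∀ K, ∑ r ∈ Finset.range (K + 1), localRule μ α β m r + ∑ r ∈ Finset.range K, μ r =
      ∑ r ∈ Finset.range K, α r + ∑ r ∈ Finset.range K, β r + max (α K) (β K) + m := by
    intro K
    induction K with
    | zero => simp [localRule]
    | succ K ih =>
      have := localRule_add hα hβ m K
      rw [Finset.sum_range_succ _ (K + 1), Finset.sum_range_succ μ, Finset.sum_range_succ α,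
        Finset.sum_range_succ β]
      omega
  have := h K
  rw [Finset.sum_range_succ μ, Finset.sum_range_succ α, Finset.sum_range_succ β]
  omega

/-- The growth diagram of a matrix. -/
def growth (m : ℕ → ℕ → ℕ) : ℕ → ℕ → ℕ → ℕ
  | 0, _ => 0
  | _ + 1, 0 => 0
  | i + 1, j + 1 => localRule (growth m i j) (growth m i (j + 1)) (growth m (i + 1) j) (m i j)

theorem growth_zero_left (m : ℕ → ℕ → ℕ) (j : ℕ) : growth m 0 j = 0 := by
  rw [growth]

theorem growth_zero_right (m : ℕ → ℕ → ℕ) (i : ℕ) : growth m i 0 = 0 := by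
  cases i <;> rw [growth]

theorem growth_succ (m : ℕ → ℕ → ℕ) (i j : ℕ) : growth m (i + 1) (j + 1) =
    localRule (growth m i j) (growth m i (j + 1)) (growth m (i + 1) j) (m i j) := by
  rw [growth]

theorem isStrip_zero : IsStrip 0 0 := fun _ => ⟨le_rfl, le_rfl⟩

theorem growth_strip (m : ℕ → ℕ → ℕ) (i : ℕ) :
    (∀ j, IsStrip (growth m i j) (growth m i (j + 1))) ∧
    ∀ j, IsStrip (growth m i j) (growth m (i + 1) j) := by
  -- The steps in `j` at level `i` yield, by induction on `j` from the zero boundary, the steps in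
  -- `i`, and with these the steps in `j` at level `i + 1`.
  have key : ∀ i, (∀ j, IsStrip (growth m i j) (growth m i (j + 1))) → ∀ j,
      IsStrip (growth m i j) (growth m (i + 1) j) ∧
      IsStrip (growth m (i + 1) j) (growth m (i + 1) (j + 1)) := by
    intro i h j
    have hs : ∀ j, IsStrip (growth m i j) (growth m (i + 1) j) →
        IsStrip (growth m i (j + 1)) (growth m (i + 1) (j + 1)) ∧
        IsStrip (growth m (i + 1) j) (growth m (i + 1) (j + 1)) := fun j hj => by
      rw [growth_succ]
      exact localRule_strip (h j) hj _
    have h1 : ∀ j, IsStrip (growth m i j) (growth m (i + 1) j) := by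
      intro j
      induction j with
      | zero => simp only [growth_zero_right]; exact isStrip_zero
      | succ j ih => exact (hs j ih).1
    exact ⟨h1 j, (hs j (h1 j)).2⟩
  have h : ∀ j, IsStrip (growth m i j) (growth m i (j + 1)) := by
    induction i with
    | zero => intro j; simp only [growth_zero_left]; exact isStrip_zero
    | succ i ih => exact fun j => (key i ih j).2
  exact ⟨h, fun j => (key i h j).1⟩

/-- A chain of partitions, starting at the empty partition, in which consecutive partitions differ
by horizontal strips. -/
structure IsStripChain (b : ℕ → ℕ → ℕ) : Prop where
  zero : b 0 = 0
  strip : ∀ j, IsStrip (b j) (b (j + 1))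

theorem growth_chain_left (m : ℕ → ℕ → ℕ) (j : ℕ) : IsStripChain fun i => growth m i j :=
  ⟨growth_zero_left m j, fun i => (growth_strip m i).2 j⟩

theorem growth_chain_right (m : ℕ → ℕ → ℕ) (i : ℕ) : IsStripChain fun j => growth m i j :=
  ⟨growth_zero_right m i, fun j => (growth_strip m i).1 j⟩

namespace IsStripChain

variable {b : ℕ → ℕ → ℕ}

theorem mono (hb : IsStripChain b) {i j : ℕ} (h : i ≤ j) (r : ℕ) : b i r ≤ b j r :=
  monotone_nat_of_le_succ (f := fun j => b j r) (fun j => (hb.strip j r).1) h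

/-- A horizontal strip adds at most one new row. This bounds the range of all row sums below. -/
theorem eq_zero (hb : IsStripChain b) {j r : ℕ} (h : j ≤ r) : b j r = 0 := by
  induction j generalizing r with
  | zero => rw [hb.zero]; rfl
  | succ j ih =>
    obtain ⟨r, rfl⟩ : ∃ s, r = s + 1 := ⟨r - 1, by omega⟩
    have := (hb.strip j r).2
    have := @ih r (by omega)
    omega

theorem antitone (hb : IsStripChain b) (j : ℕ) : Antitone (b j) := by
  apply antitone_nat_of_succ_le
  intro r
  rcases j with _ | j
  · rw [hb.zero]; rfl
  · exact (hb.strip j r).2.trans (hb.strip j r).1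

end IsStripChain

/-- `sum_localRule` is the inclusion-exclusion formula for sums over rectangles. -/
theorem sum_growth (m : ℕ → ℕ → ℕ) {i j K : ℕ} (h : j ≤ K) :
    ∑ r ∈ Finset.range (K + 1), growth m i j r =
      ∑ x ∈ Finset.range i, ∑ y ∈ Finset.range j, m x y := by
  induction i generalizing j with
  | zero => simp [growth_zero_left]
  | succ i ih =>
    induction j with
    | zero => simp [growth_zero_right]
    | succ j ihj =>
      have h1 := sum_localRule ((growth_strip m i).1 j) ((growth_strip m i).2 j) (m i j) K
        ((growth_chain_right m i).eq_zero h) ((growth_chain_right m (i + 1)).eq_zero (by omega))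
      rw [← growth_succ] at h1
      have h2 := @ih j (by omega)
      have h3 := @ih (j + 1) h
      have h4 := ihj (by omega)
      rw [Finset.sum_range_succ _ i] at h4 ⊢
      rw [Finset.sum_range_succ _ j]
      omega

/-- The rule is reversible: `localRule_add` can be solved for `μ r`, and row `0` then gives `m`. -/
theorem localRule_inj {μ α β μ' : ℕ → ℕ} (hα : IsStrip μ α) (hβ : IsStrip μ β)
    (hα' : IsStrip μ' α) (hβ' : IsStrip μ' β) {m m' : ℕ}
    (h : localRule μ α β m = localRule μ' α β m') : μ = μ' ∧ m = m' := by
  constructor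
  · funext r
    have h1 := localRule_add hα hβ m r
    have h2 := localRule_add hα' hβ' m' r
    rw [h] at h1
    omega
  · have := congrFun h 0
    simp only [localRule] at this
    omega

/-- A matrix can be recovered from the boundary of its growth diagram. -/
theorem growth_inj {m m' : ℕ → ℕ → ℕ} {N J : ℕ} (h1 : ∀ j ≤ J, growth m N j = growth m' N j)
    (h2 : ∀ i ≤ N, growth m i J = growth m' i J) {i j : ℕ} (hi : i < N) (hj : j < J) :
    m i j = m' i j := by
  have step : ∀ i j, growth m i (j + 1) = growth m' i (j + 1) →
      growth m (i + 1) j = growth m' (i + 1) j →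
      growth m (i + 1) (j + 1) = growth m' (i + 1) (j + 1) →
      growth m i j = growth m' i j ∧ m i j = m' i j := by
    intro i j e1 e2 e3
    have s1 := (growth_strip m i).1 j
    have s2 := (growth_strip m i).2 j
    have s3 := (growth_strip m' i).1 j
    have s4 := (growth_strip m' i).2 j
    rw [growth_succ, growth_succ, e1, e2] at e3
    rw [e1] at s1
    rw [e2] at s2
    exact localRule_inj s1 s2 s3 s4 e3
  -- The reversed rule is applied from the corner `(N, J)` back to the origin; `p` and `q` count the
  -- steps back.
  have key : ∀ p ≤ N, ∀ q ≤ J, growth m (N - p) (J - q) = growth m' (N - p) (J - q) := by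
    intro p
    induction p with
    | zero => intro _ q _; exact h1 _ (Nat.sub_le _ _)
    | succ p ihp =>
      intro hp q
      induction q with
      | zero => intro _; exact h2 _ (Nat.sub_le _ _)
      | succ q ihq =>
        intro hq
        have e1 := ihq (by omega)
        have e2 := ihp (by omega) (q + 1) hq
        have e3 := ihp (by omega) q (by omega)
        rw [show N - p = N - (p + 1) + 1 by omega] at e2 e3
        rw [show J - q = J - (q + 1) + 1 by omega] at e1 e3
        exact (step _ _ e1 e2 e3).1
  have key' : ∀ i ≤ N, ∀ j ≤ J, growth m i j = growth m' i j := by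
    intro i hi j hj
    have := key (N - i) (Nat.sub_le _ _) (J - j) (Nat.sub_le _ _)
    rwa [Nat.sub_sub_self hi, Nat.sub_sub_self hj] at this
  exact (step i j (key' _ (by omega) _ (by omega)) (key' _ (by omega) _ (by omega))
    (key' _ (by omega) _ (by omega))).2

/-! ### Fillings given by chains of partitions -/

namespace IsStripChain

variable {b : ℕ → ℕ → ℕ}

/-- The last partition of a chain. -/
def shape (hb : IsStripChain b) (J : ℕ) : YoungDiagram where
  cells := (Finset.range J ×ˢ Finset.range (b J 0)).filter fun c => c.2 < b J c.1
  isLowerSet := by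
    rintro ⟨r, c⟩ ⟨r', c'⟩ ⟨h1, h2⟩ h
    rw [Finset.mem_coe, Finset.mem_filter, Finset.mem_product, Finset.mem_range,
      Finset.mem_range] at h ⊢
    have h3 := hb.antitone J h1
    have h4 := hb.antitone J (Nat.zero_le r')
    dsimp only at h1 h2 h3 h ⊢
    omega

theorem mem_shape (hb : IsStripChain b) {J r c : ℕ} : (r, c) ∈ hb.shape J ↔ c < b J r := by
  rw [← YoungDiagram.mem_cells]
  simp only [shape, Finset.mem_filter, Finset.mem_product, Finset.mem_range, and_iff_right_iff_imp]
  intro h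
  refine ⟨?_, h.trans_le (hb.antitone J (Nat.zero_le r))⟩
  by_contra h'
  rw [hb.eq_zero (not_lt.1 h')] at h
  omega

end IsStripChain

/-- The filling that belongs to a chain of partitions: the cells of `b (j + 1) / b j` have entry
`j`. -/
def chainEntry (b : ℕ → ℕ → ℕ) (x : ℕ × ℕ) : ℕ := sInf {j | x.2 < b (j + 1) x.1}

namespace IsStripChain

variable {b : ℕ → ℕ → ℕ}

/-- Rows only grow along the chain, so a cell stays once it has entered. As `b 0 = 0`, it enters at
a successor index, whence the shift in `chainEntry`; membership in the shape excludes the infimum of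
the empty set. -/
theorem entry_lt_iff (hb : IsStripChain b) {J j : ℕ} {x : ℕ × ℕ} (hx : x ∈ (hb.shape J).cells) :
    chainEntry b x < j ↔ x.2 < b j x.1 := by
  have hx' : x.2 < b J x.1 := hb.mem_shape.1 hx
  have hpos : ∀ j, x.2 < b j x.1 → ∃ i, j = i + 1 := by
    rintro (_ | j) h
    · rw [hb.zero] at h; simp at h
    · exact ⟨j, rfl⟩
  constructor
  · intro h
    obtain ⟨i, rfl⟩ := hpos J hx'
    have : x.2 < b (chainEntry b x + 1) x.1 :=
      Nat.sInf_mem (s := {j | x.2 < b (j + 1) x.1}) ⟨i, hx'⟩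
    exact this.trans_le (hb.mono h _)
  · intro h
    obtain ⟨i, rfl⟩ := hpos j h
    exact Nat.lt_succ_of_le (Nat.sInf_le h)

theorem entry_lt (hb : IsStripChain b) {J : ℕ} {x : ℕ × ℕ} (hx : x ∈ (hb.shape J).cells) :
    chainEntry b x < J := (hb.entry_lt_iff hx).2 (hb.mem_shape.1 hx)

/-- A horizontal strip has at most one cell in each column: when `(r + 1, c)` is added, `(r, c)` is
already there. -/
theorem entry_lt_entry (hb : IsStripChain b) {J r c : ℕ} (hx : (r + 1, c) ∈ (hb.shape J).cells) :
    chainEntry b (r, c) < chainEntry b (r + 1, c) := by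
  have hx' : (r, c) ∈ (hb.shape J).cells :=
    (hb.shape J).isLowerSet (show (r, c) ≤ (r + 1, c) from ⟨Nat.le_succ r, le_rfl⟩) hx
  rw [hb.entry_lt_iff hx']
  have := (hb.entry_lt_iff hx).1 (Nat.lt_succ_self _)
  exact this.trans_le (hb.strip _ r).2

theorem card_entry_lt_row (hb : IsStripChain b) {J j : ℕ} (hj : j ≤ J) (r : ℕ) :
    ((hb.shape J).cells.filter fun x => chainEntry b x < j ∧ x.1 = r).card = b j r := by
  rw [← Finset.card_range (b j r)]
  refine Finset.card_bij' (fun x _ => x.2) (fun c _ => (r, c)) ?_ ?_ ?_ ?_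
  · intro x hx
    rw [Finset.mem_filter] at hx
    rw [Finset.mem_range, ← hx.2.2]
    exact (hb.entry_lt_iff hx.1).1 hx.2.1
  · intro c hc
    rw [Finset.mem_range] at hc
    have hm : (r, c) ∈ (hb.shape J).cells := hb.mem_shape.2 (hc.trans_le (hb.mono hj r))
    rw [Finset.mem_filter]
    exact ⟨hm, (hb.entry_lt_iff hm).2 hc, rfl⟩
  · intro x hx
    rw [Finset.mem_filter] at hx
    rw [← hx.2.2]
  · intro c _; rfl

theorem card_entry_lt (hb : IsStripChain b) {J j K : ℕ} (hj : j ≤ J) (hK : J ≤ K) :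
    ((hb.shape J).cells.filter fun x => chainEntry b x < j).card = ∑ r ∈ Finset.range K, b j r := by
  rw [Finset.card_eq_sum_card_fiberwise (f := Prod.fst) (t := Finset.range K)]
  · apply Finset.sum_congr rfl
    intro r _
    rw [Finset.filter_filter, hb.card_entry_lt_row hj]
  · intro x hx
    have hx := (Finset.mem_filter.1 (Finset.mem_coe.1 hx)).1
    have h1 : x.2 < b J x.1 := hb.mem_shape.1 hx
    rw [Finset.mem_coe, Finset.mem_range]
    by_contra h
    rw [hb.eq_zero (by omega)] at h1
    omega

theorem card_entry_eq (hb : IsStripChain b) {J j K : ℕ} (hj : j < J) (hK : J ≤ K) :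
    ((hb.shape J).cells.filter fun x => chainEntry b x = j).card + ∑ r ∈ Finset.range K, b j r =
      ∑ r ∈ Finset.range K, b (j + 1) r := by
  rw [← hb.card_entry_lt (Nat.succ_le_of_lt hj) hK, ← hb.card_entry_lt hj.le hK, add_comm,
    ← Finset.card_union_of_disjoint]
  · congr 1
    ext x
    simp only [Finset.mem_union, Finset.mem_filter, Nat.lt_succ_iff_lt_or_eq, ← and_or_left]
  · rw [Finset.disjoint_filter]
    intro x _ h
    omega

end IsStripChain

/-! ### A rearrangement inequality for the columns of a Young diagram -/

/-- Remove the maximum, which is at least `s.card - 1`. -/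
theorem sum_range_card_le_sum (s : Finset ℕ) : ∑ i ∈ Finset.range s.card, i ≤ ∑ x ∈ s, x := by
  induction h : s.card generalizing s with
  | zero => simp
  | succ m ih =>
    have hs : s.Nonempty := Finset.card_pos.1 (by omega)
    have hmax := s.max'_mem hs
    have h1 := ih (s.erase (s.max' hs)) (by rw [Finset.card_erase_of_mem hmax]; omega)
    have h2 : s ⊆ Finset.range (s.max' hs + 1) := fun x hx =>
      Finset.mem_range.2 (Nat.lt_succ_of_le (s.le_max' x hx))
    have h3 := Finset.card_le_card h2
    rw [Finset.card_range] at h3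
    have h4 := Finset.sum_erase_add s (fun x => x) hmax
    rw [Finset.sum_range_succ]
    omega

theorem sum_range_le_sum_of_injOn {h : ℕ} {C : ℕ → ℕ} (hC : Set.InjOn C (Finset.range h)) :
    ∑ r ∈ Finset.range h, r ≤ ∑ r ∈ Finset.range h, C r := by
  have := sum_range_card_le_sum ((Finset.range h).image C)
  rwa [Finset.card_image_of_injOn hC, Finset.card_range, Finset.sum_image hC] at this

/-- Abel summation: subtracting the last and smallest weight leaves weights that are positive and
strictly decreasing on a shorter range, plus a multiple of an unweighted sum. Equality must hold in
both pieces; induction then fixes all values but the last, and the unweighted sum fixes the last. -/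
theorem sum_mul_le_sum_mul_of_injOn {h : ℕ} {w C : ℕ → ℕ}
    (hw : ∀ r s, r < s → s < h → w s < w r) (hpos : ∀ r < h, 0 < w r)
    (hC : Set.InjOn C (Finset.range h)) :
    ∑ r ∈ Finset.range h, w r * r ≤ ∑ r ∈ Finset.range h, w r * C r ∧
      (∑ r ∈ Finset.range h, w r * r = ∑ r ∈ Finset.range h, w r * C r → ∀ r < h, C r = r) := by
  induction h generalizing w with
  | zero => simp
  | succ h ih =>
    have split : ∀ f : ℕ → ℕ, ∑ r ∈ Finset.range (h + 1), w r * f r =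
        ∑ r ∈ Finset.range h, (w r - w h) * f r + w h * ∑ r ∈ Finset.range (h + 1), f r := by
      intro f
      rw [Finset.mul_sum, Finset.sum_range_succ, Finset.sum_range_succ _ h, ← add_assoc,
        ← Finset.sum_add_distrib]
      congr 1
      apply Finset.sum_congr rfl
      intro r hr
      rw [← add_mul, Nat.sub_add_cancel (hw r h (Finset.mem_range.1 hr) (Nat.lt_succ_self h)).le]
    have hC' : Set.InjOn C (Finset.range h) :=
      hC.mono (Finset.coe_subset.2 (Finset.range_mono (Nat.le_succ h)))
    obtain ⟨h1, h2⟩ := ih (w := fun r => w r - w h)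
      (fun r s hr hs => by
        have := hw r s hr (by omega)
        have := hw s h hs (by omega)
        omega)
      (fun r hr => by have := hw r h hr (by omega); omega) hC'
    have h3 := sum_range_le_sum_of_injOn hC
    have h4 := Nat.mul_le_mul_left (w h) h3
    rw [split C, split fun r => r]
    refine ⟨add_le_add h1 h4, fun e => ?_⟩
    have h5 := h2 (by omega)
    have h6 : ∑ r ∈ Finset.range (h + 1), r = ∑ r ∈ Finset.range (h + 1), C r :=
      Nat.eq_of_mul_eq_mul_left (hpos h (Nat.lt_succ_self h)) (by omega)
    have h7 : ∑ r ∈ Finset.range h, C r = ∑ r ∈ Finset.range h, r :=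
      Finset.sum_congr rfl fun r hr => h5 r (Finset.mem_range.1 hr)
    rw [Finset.sum_range_succ, Finset.sum_range_succ, h7] at h6
    intro r hr
    rcases Nat.lt_succ_iff_lt_or_eq.1 hr with hr | rfl
    · exact h5 r hr
    · omega

/-- The previous inequality, column by column. In the applications `C` is the row function of
another tabloid read in the cells, and equality identifies the two tabloids. -/
theorem YoungDiagram.sum_mul_row_le (μ : YoungDiagram) {w C : ℕ × ℕ → ℕ}
    (hw : ∀ r c, (r + 1, c) ∈ μ.cells → w (r + 1, c) < w (r, c)) (hpos : ∀ x ∈ μ.cells, 0 < w x)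
    (hC : ∀ x ∈ μ.cells, ∀ y ∈ μ.cells, x.2 = y.2 → C x = C y → x = y) :
    ∑ x ∈ μ.cells, w x * x.1 ≤ ∑ x ∈ μ.cells, w x * C x ∧
      (∑ x ∈ μ.cells, w x * x.1 = ∑ x ∈ μ.cells, w x * C x → ∀ x ∈ μ.cells, C x = x.1) := by
  have hmaps : ∀ x ∈ μ.cells, x.2 ∈ Finset.range (μ.rowLen 0) := fun x hx =>
    Finset.mem_range.2 ((YoungDiagram.mem_iff_lt_rowLen.1
      (μ.up_left_mem (Nat.zero_le x.1) le_rfl hx)))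
  have split : ∀ f : ℕ × ℕ → ℕ, ∑ x ∈ μ.cells, f x =
      ∑ c ∈ Finset.range (μ.rowLen 0), ∑ r ∈ Finset.range (μ.colLen c), f (r, c) := by
    intro f
    rw [← Finset.sum_fiberwise_of_maps_to hmaps]
    apply Finset.sum_congr rfl
    intro c _
    have := μ.col_eq_prod (j := c)
    rw [YoungDiagram.col] at this
    rw [this, Finset.sum_product]
    simp
  have hcell : ∀ {r c}, r < μ.colLen c → (r, c) ∈ μ.cells := fun h =>
    YoungDiagram.mem_iff_lt_colLen.2 h
  have hcol : ∀ c, _ := fun c => sum_mul_le_sum_mul_of_injOn (h := μ.colLen c)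
    (w := fun r => w (r, c)) (C := fun r => C (r, c))
    (fun r s hrs hs => by
      induction s, hrs using Nat.le_induction with
      | base => exact hw _ _ (hcell hs)
      | succ s _ ih => exact (hw _ _ (hcell hs)).trans (ih (by omega)))
    (fun r hr => hpos _ (hcell hr))
    (fun r hr s hs e => congrArg Prod.fst (hC _ (hcell (Finset.mem_range.1 hr)) _
      (hcell (Finset.mem_range.1 hs)) rfl e))
  rw [split, split]
  refine ⟨Finset.sum_le_sum fun c _ => (hcol c).1, fun e x hx => ?_⟩
  have := (Finset.sum_eq_sum_iff_of_le fun c _ => (hcol c).1).1 e x.2 (hmaps x hx)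
  exact (hcol x.2).2 this x.1 (YoungDiagram.mem_iff_lt_colLen.1 hx)

/-! ### Filtrations from triangular families of maps -/

section Filtration

variable {k A M : Type*} [Field k] [Ring A] [Algebra k A] [AddCommGroup M] [Module k M]
  [Module A M] [IsScalarTower k A M]

theorem finiteDimensional_quotient_submodule [FiniteDimensional k M] (G : Submodule A M)
    (S : Submodule A G) : FiniteDimensional k (G ⧸ S) := by
  have : FiniteDimensional k G := inferInstanceAs (FiniteDimensional k (G.restrictScalars k))
  exact Module.Finite.of_surjective (S.mkQ.restrictScalars k) S.mkQ_surjective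

theorem finrank_submoduleOf_add {F G : Submodule A M} [FiniteDimensional k M] (h : F ≤ G) :
    Module.finrank k (G ⧸ F.submoduleOf G) + Module.finrank k F = Module.finrank k G := by
  have : FiniteDimensional k G := inferInstanceAs (FiniteDimensional k (G.restrictScalars k))
  rw [← Submodule.finrank_quotient_add_finrank ((F.submoduleOf G).restrictScalars k)]
  congr 1
  exact (LinearEquiv.finrank_eq ((Submodule.submoduleOfEquivOfLe h).restrictScalars k)).symm

/-- A family of maps `D i : N i → M` which is triangular with respect to functions on `M` gives a
filtration of `M` with subquotients `Q i`, provided that the dimensions add up. -/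
theorem exists_filtration_of_triangular [FiniteDimensional k M] {m : ℕ} {N Q V : Fin m → Type*}
    [∀ i, AddCommGroup (N i)] [∀ i, Module A (N i)]
    [∀ i, AddCommGroup (Q i)] [∀ i, Module k (Q i)] [∀ i, Module A (Q i)]
    [∀ i, IsScalarTower k A (Q i)] [∀ i, FiniteDimensional k (Q i)]
    [∀ i, AddCommGroup (V i)] [∀ i, Module k (V i)]
    (D : ∀ i, N i →ₗ[A] M) (q : ∀ i, N i →ₗ[A] Q i) (hq : ∀ i, Function.Surjective (q i))
    (ψ : ∀ i, M →ₗ[k] V i) (h0 : ∀ i j, j < i → ∀ y, ψ i (D j y) = 0)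
    (hD : ∀ i y, ψ i (D i y) = 0 → q i y = 0)
    (hdim : Module.finrank k M ≤ ∑ i, Module.finrank k (Q i)) :
    ∃ F : Fin (m + 1) → Submodule A M, F 0 = ⊥ ∧ F (Fin.last m) = ⊤ ∧
      ∀ i : Fin m, F i.castSucc ≤ F i.succ ∧
        Nonempty ((F i.succ ⧸ (F i.castSucc).submoduleOf (F i.succ)) ≃ₗ[A] Q i) := by
  let F : Fin (m + 1) → Submodule A M := fun i =>
    ⨆ j : {j : Fin m // j.castSucc < i}, LinearMap.range (D j)
  have hle : ∀ i : Fin m, F i.castSucc ≤ F i.succ := fun i => iSup_le fun j =>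
    le_iSup (fun j : {j : Fin m // j.castSucc < i.succ} => LinearMap.range (D j))
      ⟨j.1, j.2.trans (Fin.castSucc_lt_succ)⟩
  have hmem : ∀ i y, D i y ∈ F i.succ := fun i y =>
    le_iSup (fun j : {j : Fin m // j.castSucc < i.succ} => LinearMap.range (D j))
      ⟨i, Fin.castSucc_lt_succ⟩ ⟨y, rfl⟩
  have hsup : ∀ i : Fin m, F i.succ = F i.castSucc ⊔ LinearMap.range (D i) := by
    intro i
    apply le_antisymm
    · refine iSup_le fun j => ?_
      rcases (Fin.castSucc_lt_succ_iff.1 j.2).lt_or_eq with h | h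
      · exact le_sup_of_le_left (le_iSup (fun j : {j : Fin m // j.castSucc < i.castSucc} =>
          LinearMap.range (D j)) ⟨j.1, Fin.castSucc_lt_castSucc_iff.2 h⟩)
      · rw [h]; exact le_sup_right
    · refine sup_le (hle i) ?_
      rintro _ ⟨y, rfl⟩
      exact hmem i y
  have hker : ∀ i : Fin m, ∀ x ∈ F i.castSucc, ψ i x = 0 := by
    intro i x hx
    induction hx using Submodule.iSup_induction' with
    | mem j x hx =>
      obtain ⟨y, rfl⟩ := hx
      exact h0 i j.1 (Fin.castSucc_lt_castSucc_iff.1 j.2) y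
    | zero => exact map_zero _
    | add x y _ _ hx hy => rw [map_add, hx, hy, add_zero]
  let p : ∀ i : Fin m, N i →ₗ[A] F i.succ ⧸ (F i.castSucc).submoduleOf (F i.succ) := fun i =>
    (Submodule.mkQ _).comp ((D i).codRestrict (F i.succ) (hmem i))
  have hpsurj : ∀ i, Function.Surjective (p i) := by
    intro i x
    obtain ⟨⟨x, hx⟩, rfl⟩ := Submodule.mkQ_surjective _ x
    have hx' := hx
    rw [hsup, Submodule.mem_sup] at hx'
    obtain ⟨z, hz, _, ⟨y, rfl⟩, rfl⟩ := hx'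
    refine ⟨y, ?_⟩
    change Submodule.mkQ _ _ = Submodule.mkQ _ _
    rw [Submodule.mkQ_apply, Submodule.mkQ_apply, eq_comm, Submodule.Quotient.eq,
      Submodule.submoduleOf, Submodule.mem_comap]
    simpa using hz
  -- Triangularity enters here: if `D i y` lies in the earlier step, `ψ i` kills it and so `q i y =
  -- 0`. Hence `q i` factors through a map `r i` of the subquotient onto `Q i`.
  have hpker : ∀ i, LinearMap.ker (p i) ≤ LinearMap.ker (q i) := by
    intro i y hy
    rw [LinearMap.mem_ker] at hy ⊢
    apply hD
    apply hker
    exact (Submodule.Quotient.mk_eq_zero ((F i.castSucc).submoduleOf (F i.succ))).1 hy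
  let r : ∀ i : Fin m, (F i.succ ⧸ (F i.castSucc).submoduleOf (F i.succ)) →ₗ[A] Q i := fun i =>
    ((LinearMap.ker (p i)).liftQ (q i) (hpker i)).comp
      ((p i).quotKerEquivOfSurjective (hpsurj i)).symm.toLinearMap
  have hrsurj : ∀ i, Function.Surjective (r i) := by
    intro i x
    obtain ⟨y, rfl⟩ := hq i x
    refine ⟨(p i).quotKerEquivOfSurjective (hpsurj i) (Submodule.Quotient.mk y), ?_⟩
    simp [r]
  have hfd : ∀ i : Fin m,
      FiniteDimensional k (F i.succ ⧸ (F i.castSucc).submoduleOf (F i.succ)) := fun i =>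
    finiteDimensional_quotient_submodule _ _
  have hfin : ∀ i, Module.finrank k (Q i) ≤
      Module.finrank k (F i.succ ⧸ (F i.castSucc).submoduleOf (F i.succ)) := fun i =>
    LinearMap.finrank_le_finrank_of_surjective (f := (r i).restrictScalars k) (hrsurj i)
  have hbot : F 0 = ⊥ := by
    rw [eq_bot_iff]
    exact iSup_le fun j => absurd j.2 (Fin.not_lt_zero _)
  let d : Fin m → ℕ := fun j =>
    Module.finrank k (F j.succ ⧸ (F j.castSucc).submoduleOf (F j.succ))
  -- The dimensions of the subquotients telescope.
  have htel : ∀ i : Fin (m + 1), Module.finrank k (F i) =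
      ∑ j : Fin m with j.castSucc < i, d j := by
    intro i
    induction i using Fin.induction with
    | zero =>
      rw [hbot, Finset.sum_eq_zero fun j hj =>
        absurd (Finset.mem_filter.1 hj).2 (Fin.not_lt_zero _)]
      exact finrank_bot k M
    | succ i ih =>
      rw [← finrank_submoduleOf_add (hle i), ih]
      change d i + _ = _
      rw [← Finset.sum_insert (by simp)]
      congr 1
      ext j
      simp [Fin.castSucc_lt_succ_iff, le_iff_eq_or_lt]
  have hlast := htel (Fin.last m)
  rw [Finset.filter_true_of_mem fun j _ => Fin.castSucc_lt_last j] at hlast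
  have hle' : Module.finrank k (F (Fin.last m)) ≤ Module.finrank k M :=
    Submodule.finrank_le ((F (Fin.last m)).restrictScalars k)
  -- The chain `∑ dim Q i ≤ ∑ d i = dim F (last) ≤ dim M ≤ ∑ dim Q i` collapses to equalities, so
  -- the last step is `M` and every `r i` is bijective.
  have hsum := Finset.sum_le_sum fun i (_ : i ∈ Finset.univ) => hfin i
  refine ⟨F, hbot, ?_, fun i => ⟨hle i, ⟨?_⟩⟩⟩
  · rw [← Submodule.restrictScalars_eq_top_iff k]
    exact Submodule.eq_top_of_finrank_eq (le_antisymm hle' ((hdim.trans hsum).trans hlast.ge))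
  · have heq := (Finset.sum_eq_sum_iff_of_le fun i (_ : i ∈ Finset.univ) => hfin i).1
      (le_antisymm hsum (hlast.ge.trans (hle'.trans hdim))) i (Finset.mem_univ i)
    refine LinearEquiv.ofBijective (r i) ⟨?_, hrsurj i⟩
    exact (LinearMap.injective_iff_surjective_of_finrank_eq_finrank
      (f := (r i).restrictScalars k) heq.symm).2 (hrsurj i)

end Filtration

/-! ### Homomorphisms between permutation modules on tabloids -/

section TabloidHom

variable {X : Type*} [Fintype X] {c : ℕ → ℕ}

theorem Tabloid.smul_apply (π : Equiv.Perm X) (t : Tabloid X c) (x : X) :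
    (π • t).1 x = t.1 (π⁻¹ x) := rfl

theorem Tabloid.smul_apply_apply (π : Equiv.Perm X) (t : Tabloid X c) (x : X) :
    (π • t).1 (π x) = t.1 x := congrArg t.1 (π.symm_apply_apply x)

/-- All tabloids of one type use the same row numbers, which makes them finite in number although
their values lie in `ℕ`. -/
theorem Tabloid.apply_mem_image (t₀ t : Tabloid X c) (x : X) :
    t.1 x ∈ Finset.univ.image t₀.1 := by
  have h : 0 < c (t.1 x) := by
    rw [← t.2 (t.1 x)]
    exact Finset.card_pos.2 ⟨x, by simp⟩
  rw [← t₀.2] at h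
  obtain ⟨y, hy⟩ := Finset.card_pos.1 h
  exact Finset.mem_image.2 ⟨y, Finset.mem_univ _, (Finset.mem_filter.1 hy).2⟩

instance : Finite (Tabloid X c) := by
  rcases isEmpty_or_nonempty (Tabloid X c) with _ | ⟨⟨t₀⟩⟩
  · infer_instance
  · exact Finite.of_injective
      (fun (t : Tabloid X c) (x : X) => (⟨t.1 x, t₀.apply_mem_image t x⟩ : Finset.univ.image t₀.1))
      fun t t' h => Subtype.ext (funext fun x => congrArg Subtype.val (congrFun h x))

instance : Fintype (Tabloid X c) := Fintype.ofFinite _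

/-- The numbers of `x` with given values of `t' x` and `t x` agree with the numbers of cells of `μ`
with given row and given entry of the filling `B`. -/
def HasPosition (μ : YoungDiagram) (B : ℕ × ℕ → ℕ) (t' t : X → ℕ) : Prop :=
  Finset.univ.val.map (fun x => (t' x, t x)) = μ.cells.val.map fun y => (y.1, B y)

/-- Used with `F a b = (J - b) * a`, to read off `rowWeight J μ B` from any pair of tabloids in
position `B`. -/
theorem HasPosition.sum_eq {μ : YoungDiagram} {B : ℕ × ℕ → ℕ} {t' t : X → ℕ}
    (h : HasPosition μ B t' t) (F : ℕ → ℕ → ℕ) :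
    ∑ x, F (t' x) (t x) = ∑ y ∈ μ.cells, F y.1 (B y) := by
  have := congrArg (fun s => (s.map fun p => F p.1 p.2).sum) h
  simp only [Multiset.map_map] at this
  exact this

/-- Only the multiset of pairs of values matters, so the position is constant on orbits of pairs;
this makes `tabloidHom` equivariant. -/
theorem hasPosition_comp_iff {μ : YoungDiagram} {B : ℕ × ℕ → ℕ} {t' t : X → ℕ}
    (π : Equiv.Perm X) :
    HasPosition μ B (fun x => t' (π x)) (fun x => t (π x)) ↔ HasPosition μ B t' t := by
  rw [HasPosition, HasPosition]
  have := Multiset.map_univ_val_equiv π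
  conv_rhs => rw [← this, Multiset.map_map]
  rfl

theorem hasPosition_smul_iff {μ : YoungDiagram} {B : ℕ × ℕ → ℕ} {c' : ℕ → ℕ} (t' : Tabloid X c')
    (t : Tabloid X c) (π : Equiv.Perm X) :
    HasPosition μ B (π • t').1 (π • t).1 ↔ HasPosition μ B t'.1 t.1 :=
  hasPosition_comp_iff π⁻¹

/-- The tabloid which assigns to every entry `x` of the tableau `T` the entry in the filling `B` of
the cell of `x`. -/
def fillTabloid {μ : YoungDiagram} {B : ℕ × ℕ → ℕ}
    (hB : ∀ j, (μ.cells.filter fun y => B y = j).card = c j) (T : μ.cells ≃ X) : Tabloid X c :=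
  ⟨fun x => B (T.symm x).1, fun j => by
    rw [← hB j]
    refine Finset.card_bij' (fun x _ => (T.symm x).1)
      (fun y hy => T ⟨y, (Finset.mem_filter.1 hy).1⟩) ?_ ?_ ?_ ?_
    · intro x hx
      exact Finset.mem_filter.2 ⟨(T.symm x).2, (Finset.mem_filter.1 hx).2⟩
    · intro y hy
      simpa using (Finset.mem_filter.1 hy).2
    · intro x hx; simp
    · intro y hy; simp⟩

/-- Once `π` is cancelled, the two tabloids are in the position given by `C` itself. -/
theorem map_cells_eq_of_hasPosition {μ ν : YoungDiagram} {B C : ℕ × ℕ → ℕ}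
    {hCc : ∀ j, (ν.cells.filter fun y => C y = j).card = c j} {T : ν.cells ≃ X}
    {π : Equiv.Perm X} (h : HasPosition μ B (π • tabloidOf T).1 (π • fillTabloid hCc T).1) :
    ν.cells.val.map (fun y => (y.1, C y)) = μ.cells.val.map fun y => (y.1, B y) := by
  rw [hasPosition_smul_iff] at h
  rw [← h, ← Multiset.map_univ_val_equiv T, Multiset.map_map]
  have : ν.cells.val = (Finset.univ : Finset ν.cells).val.map Subtype.val := by
    rw [Finset.univ_eq_attach, Finset.attach_val, Multiset.attach_map_val]
  rw [this, Multiset.map_map]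
  refine Multiset.map_congr rfl fun y _ => ?_
  simp [tabloidOf, fillTabloid]

variable (k : Type*) [CommRing k]

open Classical in
/-- The homomorphism `M^μ → M^c` that belongs to a filling `B` of `μ`. -/
def tabloidHom (μ : YoungDiagram) (B : ℕ × ℕ → ℕ) (c : ℕ → ℕ) :
    k[Tabloid X μ.rowLen] →ₗ[k] k[Tabloid X c] where
  toFun y := .ofCoeff (Finsupp.equivFunOnFinite.symm fun t =>
    ∑ t' : Tabloid X μ.rowLen, if HasPosition μ B t'.1 t.1 then y.coeff t' else 0)
  map_add' y z := by
    ext t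
    simp only [MonoidAlgebra.coeff_add, Finsupp.add_apply,
      Finsupp.equivFunOnFinite_symm_apply_apply, ← Finset.sum_add_distrib]
    exact Finset.sum_congr rfl fun t' _ => by split_ifs <;> simp
  map_smul' a y := by
    ext t
    simp only [MonoidAlgebra.coeff_smul, Finsupp.smul_apply,
      Finsupp.equivFunOnFinite_symm_apply_apply, Finset.smul_sum, RingHom.id_apply]
    exact Finset.sum_congr rfl fun t' _ => by split_ifs <;> simp

open Classical in
theorem coeff_tabloidHom (μ : YoungDiagram) (B : ℕ × ℕ → ℕ) (y : k[Tabloid X μ.rowLen])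
    (t : Tabloid X c) : (tabloidHom k μ B c y).coeff t =
      ∑ t' : Tabloid X μ.rowLen, if HasPosition μ B t'.1 t.1 then y.coeff t' else 0 := rfl

variable [DecidableEq X]

open Classical in
/-- `tabloidHom`, as a homomorphism of modules over the group algebra. -/
def permutationModuleHom (μ : YoungDiagram) (B : ℕ × ℕ → ℕ) (c : ℕ → ℕ) :
    PermutationModule k X μ.rowLen →ₗ[k[Equiv.Perm X]] PermutationModule k X c :=
  Representation.IntertwiningMap.equivLinearMapAsModule _ _
    ((tabloidHom k μ B c).intertwiningMap_of_isIntertwiningMap _ _ fun g y => by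
      ext t
      rw [Representation.coeff_ofMulAction, coeff_tabloidHom, coeff_tabloidHom,
        ← Equiv.sum_comp (MulAction.toPerm g)]
      refine Finset.sum_congr rfl fun t' _ => ?_
      rw [Representation.coeff_ofMulAction, MulAction.toPerm_apply, inv_smul_smul]
      have := hasPosition_smul_iff (μ := μ) (B := B) t' (g⁻¹ • t) g
      rw [smul_inv_smul] at this
      exact if_congr this rfl rfl)

/-! ### Signed column sums and triangularity -/

variable {k}

theorem mem_colStab {μ : YoungDiagram} {T : μ.cells ≃ X} {π : Equiv.Perm X} :
    π ∈ colStab T ↔ ∀ x, (T.symm (π x)).1.2 = (T.symm x).1.2 := by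
  simp [colStab]

theorem mul_mem_colStab {μ : YoungDiagram} {T : μ.cells ≃ X} {π ρ : Equiv.Perm X}
    (hπ : π ∈ colStab T) (hρ : ρ ∈ colStab T) : π * ρ ∈ colStab T := by
  rw [mem_colStab] at *
  exact fun x => (hπ (ρ x)).trans (hρ x)

variable (k) in
/-- The signed sums of coefficients over the column stabilizers. -/
def colForm {μ : YoungDiagram} (t : (μ.cells ≃ X) → Tabloid X c) :
    k[Tabloid X c] →ₗ[k] ((μ.cells ≃ X) → k) where
  toFun z T := ∑ π ∈ colStab T, ((Equiv.Perm.sign π : ℤ) : k) * z.coeff (π • t T)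
  map_add' y z := by
    funext T
    simp [mul_add, Finset.sum_add_distrib]
  map_smul' a z := by
    funext T
    simp [Finset.mul_sum, mul_left_comm]

-- Exchanging the sums isolates, for each `t'`, a signed sum over the column stabilizer that does
-- not involve `y`.
open Classical in
theorem colForm_tabloidHom {μ ν : YoungDiagram} (B : ℕ × ℕ → ℕ)
    (t : (ν.cells ≃ X) → Tabloid X c) (y : k[Tabloid X μ.rowLen]) (T : ν.cells ≃ X) :
    colForm k t (tabloidHom k μ B c y) T = ∑ t' : Tabloid X μ.rowLen, y.coeff t' *
      ∑ π ∈ colStab T, ((Equiv.Perm.sign π : ℤ) : k) *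
        if HasPosition μ B t'.1 (π • t T).1 then 1 else 0 := by
  change ∑ π ∈ colStab T, _ = _
  simp only [coeff_tabloidHom, Finset.mul_sum]
  rw [Finset.sum_comm]
  refine Finset.sum_congr rfl fun t' _ => Finset.sum_congr rfl fun π _ => ?_
  split_ifs <;> ring

/-- The entries of each column of `T` lie in different rows of `t'`. -/
def ColInjective {μ : YoungDiagram} (T : μ.cells ≃ X) (t' : X → ℕ) : Prop :=
  ∀ x y, (T.symm x).1.2 = (T.symm y).1.2 → t' x = t' y → x = y

-- If `x` and `y` share a column of `T` and a row of `t'`, their transposition fixes `t'` and lies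
-- in the column stabilizer. Left multiplication by it reverses signs and preserves the position, so
-- the terms cancel in pairs.
open Classical in
theorem sum_sign_eq_zero {μ ν : YoungDiagram} {B : ℕ × ℕ → ℕ} {T : ν.cells ≃ X} {c' : ℕ → ℕ}
    {t' : Tabloid X c'} (h : ¬ ColInjective T t'.1) (t : Tabloid X c) :
    ∑ π ∈ colStab T, ((Equiv.Perm.sign π : ℤ) : k) *
      (if HasPosition μ B t'.1 (π • t).1 then (1 : k) else 0) = 0 := by
  simp only [ColInjective, not_forall] at h
  obtain ⟨x, y, hcol, hrow, hne⟩ := h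
  have hs : Equiv.swap x y ∈ colStab T := by
    rw [mem_colStab]
    intro z
    rcases eq_or_ne z x with rfl | hx
    · rw [Equiv.swap_apply_left, hcol]
    · rcases eq_or_ne z y with rfl | hy
      · rw [Equiv.swap_apply_right, hcol]
      · rw [Equiv.swap_apply_of_ne_of_ne hx hy]
  have hfix : Equiv.swap x y • t' = t' := by
    apply Subtype.ext
    funext z
    rw [Tabloid.smul_apply, Equiv.swap_inv]
    rcases eq_or_ne z x with rfl | hx
    · rw [Equiv.swap_apply_left, hrow]
    · rcases eq_or_ne z y with rfl | hy
      · rw [Equiv.swap_apply_right, hrow]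
      · rw [Equiv.swap_apply_of_ne_of_ne hx hy]
  refine Finset.sum_involution (fun π _ => Equiv.swap x y * π) ?_ ?_ ?_ ?_
  · intro π _
    have : HasPosition μ B t'.1 ((Equiv.swap x y * π) • t).1 ↔ HasPosition μ B t'.1 (π • t).1 := by
      conv_lhs => rw [← hfix, mul_smul]
      exact hasPosition_smul_iff _ _ _
    rw [if_congr this rfl rfl, Equiv.Perm.sign_mul, Equiv.Perm.sign_swap hne]
    split_ifs <;> simp
  · intro π _ _ e
    exact hne (Equiv.swap_eq_one_iff.1 (mul_eq_right.1 e))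
  · intro π hπ
    exact mul_mem_colStab hs hπ
  · intro π _
    rw [← mul_assoc, Equiv.swap_mul_self, one_mul]

/-- A weighted sum of the rows of the cells of a filling. -/
def rowWeight (J : ℕ) (μ : YoungDiagram) (B : ℕ × ℕ → ℕ) : ℕ := ∑ y ∈ μ.cells, (J - B y) * y.1

/-- The entries of the filling are below `J` and increase strictly down the columns. -/
structure IsColStrict (J : ℕ) (μ : YoungDiagram) (B : ℕ × ℕ → ℕ) : Prop where
  lt : ∀ y ∈ μ.cells, B y < J
  lt_below : ∀ r s, (r + 1, s) ∈ μ.cells → B (r, s) < B (r + 1, s)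

/-- Read `t'` in the cells of `ν` through `π` and `T`. The result `E` is injective on columns, and
the weights `J - C` decrease strictly down them, so `rowWeight J ν C` is at most the weighted sum of
`E`. The position makes that sum equal to `rowWeight J μ B`; with `hR` there is equality, and `E` is
the row function. -/
theorem eq_smul_tabloidOf_of_hasPosition {J : ℕ} {μ ν : YoungDiagram} {B C : ℕ × ℕ → ℕ}
    (hC : IsColStrict J ν C) (hCc : ∀ j, (ν.cells.filter fun y => C y = j).card = c j)
    (hR : rowWeight J μ B ≤ rowWeight J ν C) {T : ν.cells ≃ X} {t' : Tabloid X μ.rowLen}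
    (ht' : ColInjective T t'.1) {π : Equiv.Perm X} (hπ : π ∈ colStab T)
    (h : HasPosition μ B t'.1 (π • fillTabloid hCc T).1) :
    t'.1 = (π • tabloidOf T).1 := by
  rw [mem_colStab] at hπ
  -- The value off the diagram is a filler: `E` is only evaluated on cells.
  let E : ℕ × ℕ → ℕ := fun y => if hy : y ∈ ν.cells then t'.1 (π (T ⟨y, hy⟩)) else 0
  have hE : ∀ x, E (T.symm x).1 = t'.1 (π x) := fun x => by simp [E]
  obtain ⟨h1, h2⟩ := ν.sum_mul_row_le (w := fun y => J - C y) (C := E)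
    (fun r s hrs => by
      have := hC.lt_below r s hrs
      have := hC.lt _ hrs
      omega)
    (fun y hy => Nat.sub_pos_of_lt (hC.lt y hy))
    (fun x hx y hy hxy e => by
      have hx' := hE (T ⟨x, hx⟩)
      have hy' := hE (T ⟨y, hy⟩)
      rw [Equiv.symm_apply_apply] at hx' hy'
      have := ht' (π (T ⟨x, hx⟩)) (π (T ⟨y, hy⟩)) (by simpa [hπ] using hxy)
        (by rw [← hx', ← hy', e])
      simpa using this)
  have h3 : ∑ y ∈ ν.cells, (J - C y) * E y = rowWeight J μ B := by
    rw [rowWeight, ← h.sum_eq (fun a b => (J - b) * a), ← Equiv.sum_comp π, ← Finset.sum_coe_sort,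
      ← Equiv.sum_comp T.symm]
    refine Finset.sum_congr rfl fun x _ => ?_
    rw [Tabloid.smul_apply_apply, hE]
    rfl
  have h4 := h2 (le_antisymm h1 (h3.trans_le hR))
  funext x
  obtain ⟨x, rfl⟩ := π.surjective x
  rw [Tabloid.smul_apply_apply, ← hE, h4 _ (T.symm x).2]
  rfl

/-- A nonzero term would need `t'` to be `π • tabloidOf T`, and then `B` and `C` have the same
entries in each row. Equal weights do no harm, since `hne` separates the fillings. -/
theorem colForm_tabloidHom_eq_zero {J : ℕ} {μ ν : YoungDiagram} {B C : ℕ × ℕ → ℕ}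
    (hC : IsColStrict J ν C) (hCc : ∀ j, (ν.cells.filter fun y => C y = j).card = c j)
    (hR : rowWeight J μ B ≤ rowWeight J ν C)
    (hne : ν.cells.val.map (fun y => (y.1, C y)) ≠ μ.cells.val.map fun y => (y.1, B y))
    (y : k[Tabloid X μ.rowLen]) :
    colForm k (fillTabloid hCc) (tabloidHom k μ B c y) = 0 := by
  classical
  funext T
  rw [colForm_tabloidHom]
  refine Finset.sum_eq_zero fun t' _ => ?_
  by_cases ht' : ColInjective T t'.1
  · rw [Finset.sum_eq_zero, mul_zero]
    intro π hπ
    rw [if_neg, mul_zero]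
    intro h
    have e := eq_smul_tabloidOf_of_hasPosition hC hCc hR ht' hπ h
    rw [e] at h
    exact hne (map_cells_eq_of_hasPosition h)
  · rw [sum_sign_eq_zero ht', mul_zero]

/-- For `C = B` exactly the terms with `t' = π • tabloidOf T` survive, and their signs are those of
the polytabloid of `T`. -/
theorem colForm_tabloidHom_self {J : ℕ} {μ : YoungDiagram} {B : ℕ × ℕ → ℕ}
    (hB : IsColStrict J μ B) (hBc : ∀ j, (μ.cells.filter fun y => B y = j).card = c j)
    (y : k[Tabloid X μ.rowLen]) :
    colForm k (fillTabloid hBc) (tabloidHom k μ B c y) = colForm k tabloidOf y := by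
  classical
  funext T
  rw [colForm_tabloidHom]
  have hpos : ∀ π : Equiv.Perm X,
      HasPosition μ B (π • tabloidOf T).1 (π • fillTabloid hBc T).1 := by
    intro π
    rw [hasPosition_smul_iff, HasPosition, ← Multiset.map_univ_val_equiv T, Multiset.map_map]
    have : μ.cells.val = (Finset.univ : Finset μ.cells).val.map Subtype.val := by
      rw [Finset.univ_eq_attach, Finset.attach_val, Multiset.attach_map_val]
    rw [this, Multiset.map_map]
    refine Multiset.map_congr rfl fun y _ => ?_
    simp [tabloidOf, fillTabloid]
  have hinj : ∀ π ∈ colStab T, ColInjective T (π • tabloidOf T).1 := by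
    intro π hπ x z hxz e
    rw [mem_colStab] at hπ
    obtain ⟨x, rfl⟩ := π.surjective x
    obtain ⟨z, rfl⟩ := π.surjective z
    rw [Tabloid.smul_apply_apply, Tabloid.smul_apply_apply] at e
    rw [hπ, hπ] at hxz
    rw [T.symm.injective (Subtype.ext (Prod.ext e hxz))]
  have key : ∀ t' : Tabloid X μ.rowLen, ∑ π ∈ colStab T, ((Equiv.Perm.sign π : ℤ) : k) *
      (if HasPosition μ B t'.1 (π • fillTabloid hBc T).1 then (1 : k) else 0) =
      ∑ π ∈ colStab T, ((Equiv.Perm.sign π : ℤ) : k) *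
        (if π • tabloidOf T = t' then (1 : k) else 0) := by
    intro t'
    by_cases ht' : ColInjective T t'.1
    · refine Finset.sum_congr rfl fun π hπ => ?_
      congr 1
      refine if_congr ⟨fun h => ?_, fun h => ?_⟩ rfl rfl
      · exact (Subtype.ext (eq_smul_tabloidOf_of_hasPosition hB hBc le_rfl ht' hπ h)).symm
      · rw [← h]; exact hpos π
    · rw [sum_sign_eq_zero ht', eq_comm]
      refine Finset.sum_eq_zero fun π hπ => ?_
      rw [if_neg, mul_zero]
      rintro rfl
      exact ht' (hinj π hπ)
  simp only [key, Finset.mul_sum]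
  rw [Finset.sum_comm]
  change _ = ∑ π ∈ colStab T, _
  refine Finset.sum_congr rfl fun π _ => ?_
  rw [Finset.sum_eq_single (π • tabloidOf T)]
  · simp [mul_comm]
  · intro t' _ h
    rw [if_neg h.symm, mul_zero, mul_zero]
  · simp

end TabloidHom

/-! ### Dual Specht modules as quotients of permutation modules -/

section DualSpechtQuotient

variable {X : Type*} [Fintype X] (k : Type*)

/-- The bilinear form on a permutation module for which the tabloids are orthonormal. -/
def tabloidForm [CommRing k] (c : ℕ → ℕ) :
    k[Tabloid X c] →ₗ[k] k[Tabloid X c] →ₗ[k] k :=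
  LinearMap.mk₂ k (fun y z => ∑ t, y.coeff t * z.coeff t)
    (fun y y' z => by simp [add_mul, Finset.sum_add_distrib])
    (fun a y z => by simp [Finset.mul_sum, mul_assoc])
    (fun y z z' => by simp [mul_add, Finset.sum_add_distrib])
    (fun a y z => by simp [Finset.mul_sum, mul_left_comm])

theorem tabloidForm_apply [CommRing k] {c : ℕ → ℕ} (y z : k[Tabloid X c]) :
    tabloidForm k c y z = ∑ t, y.coeff t * z.coeff t := rfl

theorem tabloidForm_single [CommRing k] {c : ℕ → ℕ} (y : k[Tabloid X c]) (t : Tabloid X c)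
    (a : k) : tabloidForm k c y (MonoidAlgebra.single t a) = y.coeff t * a := by
  rw [tabloidForm_apply, Finset.sum_eq_single t]
  · simp
  · intro t' _ h
    simp [h.symm]
  · simp

theorem tabloidForm_surjective [CommRing k] {c : ℕ → ℕ} :
    Function.Surjective (tabloidForm (X := X) k c) := by
  intro f
  refine ⟨.ofCoeff (Finsupp.equivFunOnFinite.symm fun t => f (MonoidAlgebra.single t 1)), ?_⟩
  ext t
  simp [tabloidForm_single]

theorem tabloidForm_polytabloid [CommRing k] [DecidableEq X] {μ : YoungDiagram}
    (T : μ.cells ≃ X) (y : k[Tabloid X μ.rowLen]) :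
    tabloidForm k _ y (polytabloid k T) = colForm k tabloidOf y T := by
  rw [polytabloid, map_sum]
  refine Finset.sum_congr rfl fun π _ => ?_
  rw [tabloidForm_single, mul_comm]

theorem tabloidForm_smul [CommRing k] [DecidableEq X] {c : ℕ → ℕ} (g : Equiv.Perm X)
    (y z : k[Tabloid X c]) :
    tabloidForm k c (tabloidRep k X c g y) z = tabloidForm k c y (tabloidRep k X c g⁻¹ z) := by
  rw [tabloidForm_apply, tabloidForm_apply, ← Equiv.sum_comp (MulAction.toPerm g)]
  refine Finset.sum_congr rfl fun t _ => ?_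
  rw [Representation.coeff_ofMulAction, Representation.coeff_ofMulAction, MulAction.toPerm_apply,
    inv_smul_smul, inv_inv]

/-- The map `M^μ → S_μ` which is dual to the inclusion `S^μ → M^μ`. -/
def dualSpechtMap [CommRing k] [DecidableEq X] (μ : YoungDiagram) :
    PermutationModule k X μ.rowLen →ₗ[k[Equiv.Perm X]] DualSpecht k X μ :=
  Representation.IntertwiningMap.equivLinearMapAsModule _ _
    (((specht k X μ).toSubmodule.dualRestrict ∘ₗ
      tabloidForm k μ.rowLen).intertwiningMap_of_isIntertwiningMap _ _ fun g y => by
        ext z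
        exact tabloidForm_smul k g y z.1)

/-- Over a field a functional on the Specht module extends to `M^μ`, where the form represents it.
-/
theorem dualSpechtMap_surjective [Field k] [DecidableEq X] (μ : YoungDiagram) :
    Function.Surjective (dualSpechtMap (X := X) k μ) :=
  (Subspace.dualRestrict_surjective (W := (specht k X μ).toSubmodule)).comp
    (tabloidForm_surjective k)

/-- By `tabloidForm_polytabloid` the hypothesis is orthogonality to all polytabloids, hence to their
span. -/
theorem dualSpechtMap_eq_zero [CommRing k] [DecidableEq X] {μ : YoungDiagram}
    {y : k[Tabloid X μ.rowLen]} (h : colForm k tabloidOf y = 0) :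
    dualSpechtMap k μ ((tabloidRep k X μ.rowLen).asModuleEquiv.symm y) = 0 := by
  change (specht k X μ).toSubmodule.dualRestrict (tabloidForm k μ.rowLen y) = 0
  ext ⟨z, hz⟩
  change tabloidForm k _ y z = 0
  induction hz using Submodule.span_induction with
  | mem z hz =>
    obtain ⟨T, rfl⟩ := hz
    rw [tabloidForm_polytabloid, h]; rfl
  | zero => exact map_zero _
  | add z z' _ _ hz hz' => rw [map_add, hz, hz', add_zero]
  | smul a z _ hz => rw [map_smul, hz, smul_zero]

/-! ### Linear independence of polytabloids -/

variable {k}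

/-- The rearrangement inequality again, with weights `N - e x`: if the columns of `T` increase, its
tabloid is the unique lightest one in its polytabloid. -/
theorem weight_tabloidOf_le {N : ℕ} {μ : YoungDiagram} [DecidableEq X] (e : X ≃ Fin N)
    {T : μ.cells ≃ X} {B : ℕ × ℕ → ℕ} (hB : IsColStrict N μ B)
    (hT : ∀ y, (e (T y) : ℕ) = B y) {π : Equiv.Perm X} (hπ : π ∈ colStab T) :
    ∑ x, (N - e x) * (tabloidOf T).1 x ≤ ∑ x, (N - e x) * (π • tabloidOf T).1 x ∧
      (∑ x, (N - e x) * (tabloidOf T).1 x = ∑ x, (N - e x) * (π • tabloidOf T).1 x →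
        π • tabloidOf T = tabloidOf T) := by
  rw [mem_colStab] at hπ
  let E : ℕ × ℕ → ℕ := fun y => if hy : y ∈ μ.cells then (π • tabloidOf T).1 (T ⟨y, hy⟩) else 0
  have hE : ∀ x, E (T.symm x).1 = (π • tabloidOf T).1 x := fun x => by simp [E]
  have hπ' : ∀ x, (T.symm (π⁻¹ x)).1.2 = (T.symm x).1.2 := fun x => by
    rw [← hπ]
    exact congrArg (fun z => (T.symm z).1.2) (π.apply_symm_apply x)
  obtain ⟨h1, h2⟩ := μ.sum_mul_row_le (w := fun y => N - B y) (C := E)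
    (fun r s hrs => by
      have := hB.lt_below r s hrs
      have := hB.lt _ hrs
      omega)
    (fun y hy => Nat.sub_pos_of_lt (hB.lt y hy))
    (fun x hx y hy hxy h => by
      have hx' := hE (T ⟨x, hx⟩)
      have hy' := hE (T ⟨y, hy⟩)
      rw [Equiv.symm_apply_apply] at hx' hy'
      rw [hx', hy', Tabloid.smul_apply, Tabloid.smul_apply] at h
      have h3 : (T.symm (π⁻¹ (T ⟨x, hx⟩))).1.2 = (T.symm (π⁻¹ (T ⟨y, hy⟩))).1.2 := by
        rw [hπ', hπ']
        simpa using hxy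
      have h4 := π⁻¹.injective (T.symm.injective (Subtype.ext (Prod.ext h h3)))
      exact congrArg Subtype.val (T.injective h4))
  have h3 : ∀ F : ℕ × ℕ → ℕ, ∑ y ∈ μ.cells, (N - B y) * F y =
      ∑ x, (N - e x) * F (T.symm x).1 := by
    intro F
    rw [← Finset.sum_coe_sort, ← Equiv.sum_comp T.symm]
    refine Finset.sum_congr rfl fun x _ => ?_
    rw [← hT, Equiv.apply_symm_apply]
  rw [h3, h3] at h1 h2
  simp only [hE] at h1 h2
  refine ⟨h1, fun h => ?_⟩
  have h4 := h2 h
  apply Subtype.ext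
  funext x
  rw [← hE, h4 _ (T.symm x).2]
  rfl

open Classical in
theorem coeff_polytabloid [CommRing k] [DecidableEq X] {μ : YoungDiagram} (T : μ.cells ≃ X)
    (t : Tabloid X μ.rowLen) :
    (polytabloid k T).coeff t =
      ∑ π ∈ colStab T with π • tabloidOf T = t, ((Equiv.Perm.sign π : ℤ) : k) := by
  rw [polytabloid, MonoidAlgebra.coeff_sum, Finset.sum_filter, Finset.sum_apply']
  refine Finset.sum_congr rfl fun π _ => ?_
  rw [MonoidAlgebra.coeff_single, Finsupp.single_apply]

/-- A permutation that preserves both rows and columns of `T` is trivial, so only `π = 1`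
contributes. -/
theorem coeff_polytabloid_self [CommRing k] [DecidableEq X] {μ : YoungDiagram}
    (T : μ.cells ≃ X) : (polytabloid k T).coeff (tabloidOf T) = 1 := by
  classical
  rw [coeff_polytabloid, Finset.sum_eq_single 1]
  · simp
  · intro π hπ h
    rw [Finset.mem_filter, mem_colStab] at hπ
    refine absurd (Equiv.ext fun x => ?_) h
    have h1 : (T.symm (π x)).1.1 = (T.symm x).1.1 := by
      have h3 := Tabloid.smul_apply_apply π (tabloidOf T) x
      rw [hπ.2] at h3
      exact h3
    exact T.symm.injective (Subtype.ext (Prod.ext h1 (hπ.1 x)))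
  · intro h
    refine absurd ?_ h
    rw [Finset.mem_filter, mem_colStab]
    exact ⟨fun x => rfl, one_smul _ _⟩

/-- Polytabloids of tableaux with increasing columns and different tabloids are linearly
independent. -/
theorem linearIndependent_polytabloid [Field k] [DecidableEq X] {N : ℕ} {μ : YoungDiagram}
    (e : X ≃ Fin N) {ι : Type*} [Fintype ι] {T : ι → (μ.cells ≃ X)} {B : ι → ℕ × ℕ → ℕ}
    (hB : ∀ i, IsColStrict N μ (B i)) (hT : ∀ i y, (e (T i y) : ℕ) = B i y)
    (hinj : Function.Injective fun i => tabloidOf (T i)) :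
    LinearIndependent k fun i => polytabloid k (T i) := by
  classical
  rw [Fintype.linearIndependent_iff]
  intro g hg
  by_contra! hne
  obtain ⟨i₀, hi₀⟩ := hne
  -- Take the lightest tabloid with nonzero coefficient. If it occurred in the polytabloid of
  -- another such `T j`, then `T j` would be no heavier, hence equally heavy, and the tabloids would
  -- agree.
  obtain ⟨i, hi, hmin⟩ := Finset.exists_min_image (Finset.univ.filter fun i => g i ≠ 0)
    (fun i => ∑ x, (N - e x) * (tabloidOf (T i)).1 x) ⟨i₀, by simpa using hi₀⟩
  rw [Finset.mem_filter] at hi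
  have h := congrArg (fun z => z.coeff (tabloidOf (T i))) hg
  simp only [MonoidAlgebra.coeff_sum, Finset.sum_apply', MonoidAlgebra.coeff_smul,
    Finsupp.smul_apply, MonoidAlgebra.coeff_zero, Finsupp.coe_zero, Pi.zero_apply] at h
  rw [Finset.sum_eq_single i, coeff_polytabloid_self, smul_eq_mul, mul_one] at h
  · exact hi.2 h
  · intro j _ hji
    by_cases hj : g j = 0
    · rw [hj, zero_smul]
    · rw [coeff_polytabloid, Finset.sum_eq_zero, smul_zero]
      intro π hπ
      rw [Finset.mem_filter] at hπ
      obtain ⟨h1, h2⟩ := weight_tabloidOf_le e (hB j) (hT j) hπ.1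
      have h3 := hmin j (by simpa using hj)
      rw [hπ.2] at h1 h2
      exact absurd (hinj (h2 (le_antisymm h1 h3))).symm hji
  · simp

theorem card_le_finrank_dualSpecht [Field k] [DecidableEq X] {N : ℕ} {μ : YoungDiagram}
    (e : X ≃ Fin N) {ι : Type*} [Fintype ι] {T : ι → (μ.cells ≃ X)} {B : ι → ℕ × ℕ → ℕ}
    (hB : ∀ i, IsColStrict N μ (B i)) (hT : ∀ i y, (e (T i y) : ℕ) = B i y)
    (hinj : Function.Injective fun i => tabloidOf (T i)) :
    Fintype.card ι ≤ Module.finrank k (DualSpecht k X μ) := by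
  have h : LinearIndependent k fun i =>
      (⟨polytabloid k (T i), Submodule.subset_span ⟨T i, rfl⟩⟩ : (specht k X μ).toSubmodule) :=
    LinearIndependent.of_comp (specht k X μ).toSubmodule.subtype
      (linearIndependent_polytabloid e hB hT hinj)
  exact h.fintype_card_le_finrank.trans_eq Subspace.dual_finrank_eq.symm

end DualSpechtQuotient

/-! ### Pairs of tableaux from tabloids -/

section Insertion

theorem IsStripChain.isColStrict {b : ℕ → ℕ → ℕ} (hb : IsStripChain b) (J : ℕ) :
    IsColStrict J (hb.shape J) (chainEntry b) :=
  ⟨fun _ hy => hb.entry_lt hy, fun _ _ hy => hb.entry_lt_entry hy⟩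

theorem IsStripChain.shape_eq {a b : ℕ → ℕ → ℕ} (ha : IsStripChain a) (hb : IsStripChain b)
    {N J : ℕ} (h : a N = b J) : ha.shape N = hb.shape J := by
  ext ⟨r, c⟩
  rw [YoungDiagram.mem_cells, YoungDiagram.mem_cells, ha.mem_shape, hb.mem_shape, h]

/-- The chain is recovered from the contents of the rows alone. Hence fillings from different chains
satisfy the hypothesis `hne` of `colForm_tabloidHom_eq_zero`. -/
theorem IsStripChain.apply_eq_card {b : ℕ → ℕ → ℕ} (hb : IsStripChain b) {J j : ℕ} (hj : j ≤ J)
    (r : ℕ) : b j r = (((hb.shape J).cells.val.map fun y => (y.1, chainEntry b y)).filter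
      fun p => p.2 < j ∧ p.1 = r).card := by
  rw [Multiset.filter_map, Multiset.card_map, ← hb.card_entry_lt_row hj]
  rfl

variable {X : Type*} {N : ℕ} (e : X ≃ Fin N)

/-- A chain of partitions whose sizes increase by one defines a tableau. -/
theorem IsStripChain.exists_tableau {a : ℕ → ℕ → ℕ} (ha : IsStripChain a) {K : ℕ} (hK : N ≤ K)
    (hsize : ∀ i < N, ∑ r ∈ Finset.range K, a (i + 1) r = ∑ r ∈ Finset.range K, a i r + 1)
    {μ : YoungDiagram} (hμ : ha.shape N = μ) :
    ∃ T : μ.cells ≃ X, ∀ y, (e (T y) : ℕ) = chainEntry a y := by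
  subst hμ
  let f : (ha.shape N).cells → X := fun y => e.symm ⟨chainEntry a y, ha.entry_lt y.2⟩
  have hf : ∀ y, (e (f y) : ℕ) = chainEntry a y := fun y => by simp [f]
  -- Sizes grow by one, so every entry below `N` occurs exactly once.
  have hcard : ∀ i < N, ((ha.shape N).cells.filter fun x => chainEntry a x = i).card = 1 := by
    intro i hi
    have h1 := ha.card_entry_eq hi hK
    have h2 := hsize i hi
    omega
  have hbij : Function.Bijective f := by
    constructor
    · intro y z h
      have hyz : chainEntry a y = chainEntry a z := by rw [← hf, ← hf, h]
      exact Subtype.ext (Finset.card_le_one.1 (hcard _ (ha.entry_lt z.2)).le y.1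
        (Finset.mem_filter.2 ⟨y.2, hyz⟩) z.1 (Finset.mem_filter.2 ⟨z.2, rfl⟩))
    · intro x
      obtain ⟨y, hy⟩ := Finset.card_pos.1 (Nat.lt_of_lt_of_eq Nat.zero_lt_one
        (hcard (e x) (e x).2).symm)
      rw [Finset.mem_filter] at hy
      exact ⟨⟨y, hy.1⟩, e.injective (Fin.ext ((hf _).trans hy.2))⟩
  exact ⟨Equiv.ofBijective f hbij, hf⟩

variable [Fintype X]

/-- The partitions count small entries in each row, so the tabloid of `T` already determines the
chain. This supplies the different tabloids that `linearIndependent_polytabloid` requires. -/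
theorem IsStripChain.apply_eq_card_tabloidOf {a : ℕ → ℕ → ℕ} (ha : IsStripChain a)
    {μ : YoungDiagram} (hμ : ha.shape N = μ) {T : μ.cells ≃ X}
    (hT : ∀ y, (e (T y) : ℕ) = chainEntry a y) {i : ℕ} (hi : i ≤ N) (r : ℕ) :
    a i r = (Finset.univ.filter fun x => (e x : ℕ) < i ∧ (tabloidOf T).1 x = r).card := by
  subst hμ
  rw [← ha.card_entry_lt_row hi]
  refine Finset.card_bij' (fun y hy => T ⟨y, (Finset.mem_filter.1 hy).1⟩)
    (fun x _ => (T.symm x).1) ?_ ?_ ?_ ?_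
  · intro y hy
    rw [Finset.mem_filter] at hy ⊢
    rw [hT]
    refine ⟨Finset.mem_univ _, hy.2.1, ?_⟩
    simpa [tabloidOf] using hy.2.2
  · intro x hx
    rw [Finset.mem_filter] at hx ⊢
    refine ⟨(T.symm x).2, ?_, hx.2.2⟩
    rw [← hT, Equiv.apply_symm_apply]
    exact hx.2.1
  · intro y hy; simp
  · intro x hx; simp

/-- The `0`-`1`-matrix of a function on `X`. -/
def wordMatrix (t : X → ℕ) (i j : ℕ) : ℕ :=
  (Finset.univ.filter fun x => (e x : ℕ) = i ∧ t x = j).card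

theorem wordMatrix_injective {t t' : X → ℕ} {J : ℕ} (ht : ∀ x, t x < J)
    (h : ∀ i < N, ∀ j < J, wordMatrix e t i j = wordMatrix e t' i j) : t = t' := by
  funext x
  have h1 : 0 < wordMatrix e t (e x) (t x) := Finset.card_pos.2 ⟨x, by simp⟩
  rw [h _ (e x).2 _ (ht x)] at h1
  obtain ⟨y, hy⟩ := Finset.card_pos.1 h1
  rw [Finset.mem_filter] at hy
  rw [← hy.2.2, e.injective (Fin.ext hy.2.1)]

/-- Row sums `1` make one edge of the growth diagram grow a cell at a time, so that it is a tableau;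
the column sums give the content of the other edge. -/
theorem sum_wordMatrix_row {t : X → ℕ} {J : ℕ} (ht : ∀ x, t x < J) {i : ℕ} (hi : i < N) :
    ∑ j ∈ Finset.range J, wordMatrix e t i j = 1 := by
  have h := Finset.card_eq_sum_card_fiberwise (s := Finset.univ.filter fun x => (e x : ℕ) = i)
    (f := t) (t := Finset.range J) fun x _ => Finset.mem_coe.2 (Finset.mem_range.2 (ht x))
  simp only [Finset.filter_filter] at h
  rw [show (∑ j ∈ Finset.range J, wordMatrix e t i j) = _ from h.symm, Finset.card_eq_one]
  refine ⟨e.symm ⟨i, hi⟩, ?_⟩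
  ext x
  simp [Equiv.eq_symm_apply, Fin.ext_iff]

theorem sum_wordMatrix_col (t : X → ℕ) (j : ℕ) :
    ∑ i ∈ Finset.range N, wordMatrix e t i j = (Finset.univ.filter fun x => t x = j).card := by
  have h := Finset.card_eq_sum_card_fiberwise (s := Finset.univ.filter fun x => t x = j)
    (f := fun x => (e x : ℕ)) (t := Finset.range N) fun x _ =>
      Finset.mem_coe.2 (Finset.mem_range.2 (e x).2)
  simp only [Finset.filter_filter] at h
  rw [h]
  exact Finset.sum_congr rfl fun i _ =>
    congrArg Finset.card (Finset.filter_congr fun x _ => and_comm)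

variable {c : ℕ → ℕ} {J : ℕ} (hc : ∀ j, J ≤ j → c j = 0)
include hc

theorem Tabloid.apply_lt (t : Tabloid X c) (x : X) : t.1 x < J := by
  by_contra h
  have h1 := t.2 (t.1 x)
  rw [hc _ (not_lt.1 h), Finset.card_eq_zero] at h1
  have : x ∈ Finset.univ.filter fun y => t.1 y = t.1 x := by simp
  rw [h1] at this
  simp at this

/-- A combinatorial form of Young's rule: the tabloids with row lengths `c` inject into the pairs
of a filling with content `c` and a standard tableau of the same shape. -/
theorem exists_fillings : ∃ (ι : Type) (_ : Fintype ι) (μ : ι → YoungDiagram)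
    (B : ι → ℕ × ℕ → ℕ) (κ : Tabloid X c → ι) (T : ∀ t, (μ (κ t)).cells ≃ X)
    (C : Tabloid X c → ℕ × ℕ → ℕ),
    (∀ i, IsColStrict J (μ i) (B i)) ∧
    (∀ i j, ((μ i).cells.filter fun y => B i y = j).card = c j) ∧
    (∀ i i', (μ i).cells.val.map (fun y => (y.1, B i y)) =
      (μ i').cells.val.map (fun y => (y.1, B i' y)) → i = i') ∧
    Function.Surjective κ ∧
    (∀ t, IsColStrict N (μ (κ t)) (C t)) ∧
    (∀ t y, (e (T t y) : ℕ) = C t y) ∧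
    ∀ t t', κ t = κ t' → (tabloidOf (T t)).1 = (tabloidOf (T t')).1 → t = t' := by
  classical
  let m : Tabloid X c → ℕ → ℕ → ℕ := fun t => wordMatrix e t.1
  have ha : ∀ t, IsStripChain fun i => growth (m t) i J := fun t => growth_chain_left _ _
  have hb : ∀ t, IsStripChain fun j => growth (m t) N j := fun t => growth_chain_right _ _
  -- The edge `i = N`, cut off at `j = J`, is the filling. Its range is the index type, so `κ` is
  -- surjective by construction, and `w` picks a tabloid for each filling.
  let key : Tabloid X c → Fin (J + 1) → ℕ → ℕ := fun t j => growth (m t) N j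
  let κ : Tabloid X c → Set.range key := fun t => ⟨key t, t, rfl⟩
  choose w hw using fun i : Set.range key => i.2
  have hκw : ∀ i, κ (w i) = i := fun i => Subtype.ext (hw i)
  have hkey : ∀ t j, j ≤ J → growth (m (w (κ t))) N j = growth (m t) N j := fun t j hj =>
    congrFun (hw (κ t)) ⟨j, Nat.lt_succ_of_le hj⟩
  let μ : Set.range key → YoungDiagram := fun i => (hb (w i)).shape J
  have hμ : ∀ t, (ha t).shape N = μ (κ t) := fun t =>
    (ha t).shape_eq (hb _) (hkey t J le_rfl).symm
  -- The number of rows summed must exceed `J` for `sum_growth` and be at least `N` for the tableau.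
  choose T hT using fun t => (ha t).exists_tableau e (K := max N J + 1)
    (le_max_left N J |>.trans (Nat.le_succ _)) (fun i hi => by
      rw [sum_growth _ (le_max_right N J), sum_growth _ (le_max_right N J),
        Finset.sum_range_succ, sum_wordMatrix_row e (t.apply_lt hc) hi]) (hμ t)
  refine ⟨Set.range key, Fintype.ofFinite _, μ, fun i => chainEntry fun j => growth (m (w i)) N j,
    κ, T, fun t => chainEntry fun i => growth (m t) i J, fun i => (hb _).isColStrict J, ?_, ?_,
    fun i => ⟨w i, hκw i⟩, fun t => ?_, hT, ?_⟩
  · intro i j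
    rcases lt_or_ge j J with hj | hj
    · have h := (hb (w i)).card_entry_eq hj (K := J + 1) (Nat.le_succ J)
      rw [sum_growth _ hj.le, sum_growth _ (Nat.succ_le_of_lt hj)] at h
      simp only [Finset.sum_range_succ _ j, Finset.sum_add_distrib] at h
      rw [sum_wordMatrix_col, (w i).2, add_comm] at h
      exact Nat.add_left_cancel h
    · rw [hc j hj, Finset.card_eq_zero, Finset.filter_eq_empty_iff]
      intro y hy
      exact ((hb (w i)).entry_lt hy |>.trans_le hj).ne
  · intro i i' h
    rw [← hκw i, ← hκw i']
    apply Subtype.ext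
    funext j r
    have h1 := (hb (w i)).apply_eq_card (Nat.le_of_lt_succ j.2) r
    have h2 := (hb (w i')).apply_eq_card (Nat.le_of_lt_succ j.2) r
    rw [h] at h1
    exact h1.trans h2.symm
  · have := (ha t).isColStrict N
    rwa [hμ] at this
  · intro t t' h1 h2
    apply Subtype.ext
    apply wordMatrix_injective e (t.apply_lt hc)
    intro i hi j hj
    -- One edge is given by `κ`, the other by the tabloid of the standard tableau.
    refine growth_inj (m := m t) (m' := m t') (fun j hj => ?_) (fun i hi => ?_) hi hj
    · rw [← hkey t j hj, ← hkey t' j hj, h1]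
    · funext r
      rw [(ha t).apply_eq_card_tabloidOf e (hμ t) (hT t) hi,
        (ha t').apply_eq_card_tabloidOf e (hμ t') (hT t') hi, h2]

/-- A finite direct sum of copies of a permutation module on tabloids has a filtration by dual
Specht modules. -/
theorem dualSpechtFiltered_permutationModule (k : Type*) [Field k] [DecidableEq X] (s : ℕ) :
    DualSpechtFiltered k X (Fin s → PermutationModule k X c) := by
  classical
  obtain ⟨ι, _, μ, B, κ, T, C, hB, hBc, hinj, hκ, hC, hT, hfib⟩ :=
    exists_fillings (Fintype.equivFin X) hc
  let g₀ : Fin (Fintype.card (Fin s × ι)) ≃ Fin s × ι := (Fintype.equivFin _).symm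
  let R : Fin s × ι → ℕ := fun p => rowWeight J (μ p.2) (B p.2)
  -- Increasing weight is the order in which earlier maps are killed by later forms; ties may be
  -- broken arbitrarily.
  let g : Fin (Fintype.card (Fin s × ι)) ≃ Fin s × ι := (Tuple.sort (R ∘ g₀)).trans g₀
  have hg : Monotone (R ∘ g) := Tuple.monotone_sort (R ∘ g₀)
  have hfd : Module.Finite k k[Tabloid X c] :=
    Module.Finite.equiv (MonoidAlgebra.coeffLinearEquiv k).symm
  have hfr : Module.finrank k (PermutationModule k X c) = Fintype.card (Tabloid X c) := by
    rw [((tabloidRep k X c).asModuleEquiv.trans (MonoidAlgebra.coeffLinearEquiv k)).finrank_eq,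
      Module.finrank_finsupp_self]
  have hfdS : ∀ μ : YoungDiagram, Module.Finite k (specht k X μ).toSubmodule := fun μ => by
    have : Module.Finite k k[Tabloid X μ.rowLen] :=
      Module.Finite.equiv (MonoidAlgebra.coeffLinearEquiv k).symm
    infer_instance
  -- The fibre of `κ` over `i` indexes independent polytabloids of shape `μ i`.
  have hcard : Fintype.card (Tabloid X c) ≤ ∑ i, Module.finrank k (DualSpecht k X (μ i)) := by
    rw [← Finset.card_univ, Finset.card_eq_sum_card_fiberwise (f := κ) (t := Finset.univ)
      fun _ _ => Finset.mem_coe.2 (Finset.mem_univ _)]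
    refine Finset.sum_le_sum fun i _ => ?_
    rw [← Fintype.card_subtype]
    have hrec : ∀ t : {t // κ t = i}, ∃ T' : (μ i).cells ≃ X,
        IsColStrict (Fintype.card X) (μ i) (C t) ∧ (∀ y, (Fintype.equivFin X (T' y) : ℕ) = C t y) ∧
          (tabloidOf T').1 = (tabloidOf (T t)).1 := by
      rintro ⟨t, rfl⟩
      exact ⟨T t, hC t, hT t, rfl⟩
    choose T' h1 h2 h3 using hrec
    refine card_le_finrank_dualSpecht (Fintype.equivFin X) h1 h2 fun t t' h => ?_
    refine Subtype.ext (hfib _ _ (t.2.trans t'.2.symm) ?_)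
    rw [← h3, ← h3, show tabloidOf (T' t) = tabloidOf (T' t') from h]
  obtain ⟨F, hF0, hF1, hF⟩ := exists_filtration_of_triangular (k := k)
    (A := k[Equiv.Perm X]) (M := Fin s → PermutationModule k X c)
    (N := fun i => PermutationModule k X (μ (g i).2).rowLen)
    (Q := fun i => DualSpecht k X (μ (g i).2))
    (V := fun i => ((μ (g i).2).cells ≃ X) → k)
    (fun i => (LinearMap.single _ (fun _ : Fin s => PermutationModule k X c) (g i).1).comp
      (permutationModuleHom k (μ (g i).2) (B (g i).2) c))
    (fun i => dualSpechtMap k (μ (g i).2)) (fun i => dualSpechtMap_surjective k _)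
    (fun i => (colForm k (fillTabloid (hBc (g i).2))) ∘ₗ
      (tabloidRep k X c).asModuleEquiv.toLinearMap ∘ₗ LinearMap.proj (g i).1)
    -- In the same copy of the permutation module the weights decide; images in different copies
    -- vanish under the projection.
    (fun i j hji y => by
      by_cases h : (g j).1 = (g i).1
      · have hne : (g i).2 ≠ (g j).2 := fun h' => hji.ne (g.injective (Prod.ext h h'.symm))
        change colForm k _ ((Pi.single (g j).1 _ : Fin s → PermutationModule k X c) (g i).1) = 0
        rw [← h, Pi.single_eq_same]
        exact colForm_tabloidHom_eq_zero (hB _) (hBc _) (hg hji.le)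
          (fun h' => hne (hinj _ _ h')) y
      · change colForm k _ ((Pi.single (g j).1 _ : Fin s → PermutationModule k X c) (g i).1) = 0
        rw [Pi.single_eq_of_ne (Ne.symm h)]
        exact map_zero _)
    (fun i y h => by
      apply dualSpechtMap_eq_zero
      refine (colForm_tabloidHom_self (hB (g i).2) (hBc (g i).2) _).symm.trans (Eq.trans ?_ h)
      change _ = colForm k _ ((Pi.single (g i).1 _ : Fin s → PermutationModule k X c) (g i).1)
      rw [Pi.single_eq_same]
      rfl)
    (by
      rw [Module.finrank_pi_fintype, Equiv.sum_comp g fun p : Fin s × ι =>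
        Module.finrank k (DualSpecht k X (μ p.2)), Fintype.sum_prod_type]
      exact Finset.sum_le_sum fun _ _ => hfr.trans_le hcard)
  refine ⟨_, F, hF0, hF1, fun i => ⟨(hF i).1, μ (g i).2, ?_, (hF i).2⟩⟩
  -- A tabloid over this index provides a tableau, hence the number of cells.
  obtain ⟨t, ht⟩ := hκ (g i).2
  rw [← ht, ← Fintype.card_congr (T t), Fintype.card_coe]

end Insertion

/-! ### The permutation module on the cosets of a Young subgroup -/

theorem Tabloid.exists_smul_eq {X : Type*} [Fintype X] {c : ℕ → ℕ} (t t' : Tabloid X c) :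
    ∃ π : Equiv.Perm X, π • t = t' := by
  let E : ∀ j, {x // t'.1 x = j} ≃ {x // t.1 x = j} := fun j => Fintype.equivOfCardEq <| by
    rw [Fintype.card_subtype, Fintype.card_subtype, t.2, t'.2]
  let π : Equiv.Perm X := (Equiv.sigmaFiberEquiv t'.1).symm.trans
    ((Equiv.sigmaCongrRight E).trans (Equiv.sigmaFiberEquiv t.1))
  refine ⟨π⁻¹, Subtype.ext (funext fun x => ?_)⟩
  rw [Tabloid.smul_apply, inv_inv]
  exact (E (t'.1 x) ⟨x, rfl⟩).2

namespace PartialDiagram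

/-! ### A `γ`-tabloid whose rows are the labelled parts -/

section Gamma

variable {l n : ℕ} (v : PartialDiagram l n)

theorem count_gammaList (a : ℕ) : v.gammaList.count a = v.alpha a := by
  -- No part has more than `l` dots, so cutting the sizes off at `l` loses nothing.
  have halpha : l < a → v.alpha a = 0 := fun h => by
    rw [alpha, Finset.card_eq_zero, Finset.filter_eq_empty_iff]
    intro p _ hp
    have := p.card_le_univ
    rw [Fintype.card_fin] at this
    omega
  have key : ∀ m, ((List.range m).flatMap fun i => List.replicate (v.alpha i) i).count a =
      if a < m then v.alpha a else 0 := by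
    intro m
    induction m with
    | zero => simp
    | succ m ih =>
      rw [List.range_succ, List.flatMap_append, List.count_append, ih, List.flatMap_singleton,
        List.count_replicate]
      rcases lt_trichotomy a m with h | rfl | h
      · simp [h, h.trans (Nat.lt_succ_self m), h.ne']
      · simp
      · simp [h.ne, h.not_gt, show ¬ a < m + 1 by omega]
  rw [gammaList, key]
  split_ifs with h
  · rfl
  · exact (halpha (by omega)).symm

/-- Both lists of sizes have the same multiplicities, and the rearrangement between them lifts along
`Finset.card` to the parts themselves. -/
theorem exists_list : ∃ L : List (Finset (Fin l)), L.Perm v.labelled.toList ∧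
    v.gammaList = L.map Finset.card := by
  have h : v.gammaList.Perm (v.labelled.toList.map Finset.card) := by
    rw [List.perm_iff_count]
    intro a
    rw [count_gammaList, ← Multiset.coe_count, ← Multiset.map_coe, Finset.coe_toList,
      Multiset.count_map, alpha, Finset.card_def, Finset.filter_val]
    simp only [eq_comm]
  have := List.eq_map_comp_perm (Finset.card (α := Fin l))
  rw [← congrFun (congrFun this v.gammaList) v.labelled.toList] at h
  obtain ⟨L, h1, h2⟩ := h
  exact ⟨L, h2, h1⟩

theorem part_mem_labelled (x : v.LabelledDot) : v.partition.part x.1 ∈ v.labelled := by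
  obtain ⟨p, hp, hx⟩ := x.2
  rwa [v.partition.part_eq_of_mem (v.labelled_subset hp) hx]

theorem extend_apply (ζ : Equiv.Perm v.LabelledDot) (x : v.LabelledDot) :
    v.extend ζ x.1 = (ζ x).1 := Equiv.Perm.ofSubtype_apply_coe ζ x

theorem mem_youngParts_iff_part {ζ : Equiv.Perm v.LabelledDot} :
    ζ ∈ v.youngParts ↔ ∀ x, v.partition.part (ζ x).1 = v.partition.part x.1 := by
  rw [mem_youngParts]
  constructor
  · intro h x
    rw [v.partition.part_eq_iff_mem (v.labelled_subset (v.part_mem_labelled x)),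
      ← h _ (v.part_mem_labelled x), ← extend_apply]
    exact Finset.smul_mem_smul_finset (v.partition.mem_part (Finset.mem_univ _))
  · intro h p hp
    apply Finset.eq_of_subset_of_card_le
    · intro x hx
      obtain ⟨y, hy, rfl⟩ := Finset.mem_smul_finset.1 hx
      have h1 := h ⟨y, p, hp, hy⟩
      rw [← extend_apply, v.partition.part_eq_of_mem (v.labelled_subset hp) hy] at h1
      exact (v.partition.part_eq_iff_mem (v.labelled_subset hp)).1 h1
    · rw [Finset.card_smul_finset]

/-- There is a `γ`-tabloid whose rows are the labelled parts. -/
theorem exists_tabloid_youngParts : ∃ t : Tabloid v.LabelledDot v.gamma,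
    ∀ ζ : Equiv.Perm v.LabelledDot, ζ • t = t ↔ ζ ∈ v.youngParts := by
  obtain ⟨L, hL, hg⟩ := v.exists_list
  have hmem : ∀ x : v.LabelledDot, v.partition.part x.1 ∈ L := fun x =>
    hL.mem_iff.2 (Finset.mem_toList.2 (v.part_mem_labelled x))
  have hnd : L.Nodup := hL.nodup_iff.2 (Finset.nodup_toList _)
  have hidx : ∀ x y : v.LabelledDot, L.idxOf (v.partition.part x.1) =
      L.idxOf (v.partition.part y.1) ↔ v.partition.part x.1 = v.partition.part y.1 := fun x y =>
    List.idxOf_inj (hmem x)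
  refine ⟨⟨fun x => L.idxOf (v.partition.part x.1), fun j => ?_⟩, fun ζ => ?_⟩
  · rw [gamma, hg]
    rcases lt_or_ge j L.length with hj | hj
    · rw [List.getD_eq_getElem _ _ (by simpa using hj), List.getElem_map]
      have hp : GetElem.getElem L j hj ∈ v.labelled :=
        Finset.mem_toList.1 (hL.mem_iff.1 (List.getElem_mem hj))
      refine Finset.card_bij' (fun x _ => x.1) (fun x hx => ⟨x, _, hp, hx⟩) ?_ ?_ ?_ ?_
      · intro x hx
        have hx := (Finset.mem_filter.1 hx).2
        rw [← v.partition.part_eq_iff_mem (v.labelled_subset hp)]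
        subst hx
        exact (List.getElem_idxOf _).symm
      · intro x hx
        refine Finset.mem_filter.2 ⟨Finset.mem_univ _, ?_⟩
        exact (congrArg (L.idxOf ·) (v.partition.part_eq_of_mem (v.labelled_subset hp) hx)).trans
          (hnd.idxOf_getElem j hj)
      · intro x _; rfl
      · intro x _; rfl
    · rw [List.getD_eq_default _ _ (by simpa using hj), Finset.card_eq_zero,
        Finset.filter_eq_empty_iff]
      intro x _
      exact ((List.idxOf_lt_length_of_mem (hmem x)).trans_le hj).ne
  -- The action on tabloids is by `t (ζ⁻¹ x)`, so fixing `t` is a condition on `ζ⁻¹`.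
  · rw [← inv_mem_iff (x := ζ), mem_youngParts_iff_part]
    constructor
    · intro h x
      exact (hidx _ _).1 (congrFun (congrArg Subtype.val h) x)
    · intro h
      exact Subtype.ext (funext fun x => (hidx _ _).2 (h x))

end Gamma

/-! ### The induced module as a permutation module -/

section Induced

variable {k : Type*} [CommRing k] {l n : ℕ} (v : PartialDiagram l n)

theorem Induced.single_smul_of (τ ζ : Equiv.Perm v.LabelledDot) (a : k) :
    (MonoidAlgebra.single τ a : k[Equiv.Perm v.LabelledDot]) • (Induced.of v ζ : Induced k v) =
      a • Induced.of v (τ * ζ) := by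
  have h : (MonoidAlgebra.single τ a : k[Equiv.Perm v.LabelledDot]) =
      a • MonoidAlgebra.single τ 1 := by simp
  rw [h, smul_assoc, Induced.of, TensorOver.smul_tmul, MonoidAlgebra.single_mul_single, one_mul]
  rfl

theorem Induced.of_eq_of_iff {τ τ' : Equiv.Perm v.LabelledDot} (h : τ'⁻¹ * τ ∈ v.youngParts) :
    (Induced.of v τ : Induced k v) = Induced.of v τ' := by
  rw [← Induced.of_mul_young v τ' h, mul_inv_cancel_left]

theorem Induced.span_of : Submodule.span k (Set.range (Induced.of v : _ → Induced k v)) = ⊤ := by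
  rw [eq_top_iff]
  rintro x -
  obtain ⟨x, rfl⟩ := TensorOver.mk_surjective _ _ x
  induction x using TensorProduct.induction_on with
  | zero => rw [map_zero]; exact Submodule.zero_mem _
  | add x y hx hy => rw [map_add]; exact Submodule.add_mem _ hx hy
  | tmul a c =>
    induction a using MonoidAlgebra.induction_linear with
    | zero => rw [TensorProduct.zero_tmul, map_zero]; exact Submodule.zero_mem _
    | add a b ha hb => rw [TensorProduct.add_tmul, map_add]; exact Submodule.add_mem _ ha hb
    | single τ a =>
      have h : (MonoidAlgebra.single τ a : k[Equiv.Perm v.LabelledDot]) ⊗ₜ[k] c =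
          (a * c) • ((MonoidAlgebra.single τ 1 : k[Equiv.Perm v.LabelledDot]) ⊗ₜ[k] (1 : k)) := by
        rw [mul_smul, ← TensorProduct.tmul_smul, TensorProduct.smul_tmul']
        simp
      rw [h, LinearMap.map_smul_of_tower]
      exact Submodule.smul_mem _ _ (Submodule.subset_span ⟨τ, rfl⟩)

variable (k)

/-- The induced module `k Σ_{l₁} ⊗_{k Σ_γ} k` is the permutation module on the `γ`-tabloids. -/
theorem nonempty_induced_equiv : Nonempty (Induced k v ≃ₗ[k[Equiv.Perm v.LabelledDot]]
    PermutationModule k v.LabelledDot v.gamma) := by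
  obtain ⟨t, ht⟩ := v.exists_tabloid_youngParts
  let u : PermutationModule k v.LabelledDot v.gamma :=
    (tabloidRep k v.LabelledDot v.gamma).asModuleEquiv.symm (MonoidAlgebra.single t 1)
  have hu : ∀ (τ : Equiv.Perm v.LabelledDot) (a : k),
      (MonoidAlgebra.single τ a : k[Equiv.Perm v.LabelledDot]) • u =
      (tabloidRep k v.LabelledDot v.gamma).asModuleEquiv.symm (MonoidAlgebra.single (τ • t) a) := by
    intro τ a
    rw [Representation.single_smul]
    change a • tabloidRep k v.LabelledDot v.gamma τ (MonoidAlgebra.single t 1) =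
      MonoidAlgebra.single (τ • t) a
    rw [Representation.ofMulAction_single]
    simp
  let f : Induced k v →ₗ[k[Equiv.Perm v.LabelledDot]] PermutationModule k v.LabelledDot v.gamma :=
    TensorOver.lift (LinearMap.toSpanSingleton k _ u) fun r c => by
      induction r using MonoidAlgebra.induction_linear with
      | zero => simp
      | add r r' h h' => rw [map_add, map_add, LinearMap.add_apply, map_add, h, h', add_smul]
      | single ζ a =>
        have h1 := hu ζ a
        rw [(ht ζ).2 ζ.2] at h1
        simp only [MonoidAlgebra.mapDomainAlgHom_apply, MonoidAlgebra.mapDomain_single,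
          Subgroup.coe_subtype, Representation.asAlgebraHom_single, LinearMap.toSpanSingleton_apply,
          LinearMap.smul_apply, Representation.isTrivial_def, LinearMap.id_apply, smul_eq_mul]
        rw [smul_comm, h1, mul_comm, mul_smul]
        congr 1
        change a • MonoidAlgebra.single t (1 : k) = MonoidAlgebra.single t a
        simp
  have hf : ∀ τ, f (Induced.of v τ) =
      (tabloidRep k v.LabelledDot v.gamma).asModuleEquiv.symm (MonoidAlgebra.single (τ • t) 1) := by
    intro τ
    rw [Induced.of, TensorOver.lift_tmul, LinearMap.toSpanSingleton_apply, one_smul, hu]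
  -- Another permutation taking `t` to `t'` differs from `ρ t'` by an element of the stabilizer
  -- `Σ_γ`, so the class of `ρ t' ⊗ 1` does not depend on the choice.
  choose ρ hρ using fun t' => Tabloid.exists_smul_eq t t'
  let g : PermutationModule k v.LabelledDot v.gamma →ₗ[k] Induced k v :=
    Finsupp.linearCombination k (fun t' => (Induced.of v (ρ t') : Induced k v)) ∘ₗ
      (MonoidAlgebra.coeffLinearEquiv k).toLinearMap ∘ₗ
      (tabloidRep k v.LabelledDot v.gamma).asModuleEquiv.toLinearMap
  have hg : ∀ t', g ((tabloidRep k v.LabelledDot v.gamma).asModuleEquiv.symm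
      (MonoidAlgebra.single t' 1)) = Induced.of v (ρ t') := by
    intro t'
    change Finsupp.linearCombination k _ (Finsupp.single t' 1) = _
    rw [Finsupp.linearCombination_single, one_smul]
  have hgf : g ∘ₗ f.restrictScalars k = LinearMap.id := by
    apply LinearMap.ext_on_range (Induced.span_of v)
    intro τ
    change g (f _) = _
    rw [hf, hg]
    apply Induced.of_eq_of_iff
    rw [← ht, mul_smul, hρ, inv_smul_smul]
  have hfg : f.restrictScalars k ∘ₗ g ∘ₗ
      (tabloidRep k v.LabelledDot v.gamma).asModuleEquiv.symm.toLinearMap =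
      (tabloidRep k v.LabelledDot v.gamma).asModuleEquiv.symm.toLinearMap := by
    apply MonoidAlgebra.lhom_ext'
    intro t'
    ext
    change f (g ((tabloidRep k v.LabelledDot v.gamma).asModuleEquiv.symm
      (MonoidAlgebra.single t' 1))) = (tabloidRep k v.LabelledDot v.gamma).asModuleEquiv.symm
      (MonoidAlgebra.single t' 1)
    rw [hg, hf, hρ]
  refine ⟨LinearEquiv.ofBijective f ⟨?_, ?_⟩⟩
  · exact Function.LeftInverse.injective (g := g) fun x => LinearMap.congr_fun hgf x
  · intro y
    exact ⟨g y, LinearMap.congr_fun hfg ((tabloidRep k v.LabelledDot v.gamma).asModuleEquiv y)⟩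

end Induced

end PartialDiagram

/-! ### The isomorphism with the tensor induced module -/

namespace PartialDiagram

section BimoduleIso

variable (k : Type*) [CommRing k] {l n : ℕ} {v : PartialDiagram l n} {s : ℕ}
  (σ : CosetReps v.youngAlpha s)

theorem TensorBimodule.hom_ext {P : Type*} [AddCommGroup P] [Module k P]
    [Module k[Equiv.Perm v.LabelledDot] P] [IsScalarTower k k[Equiv.Perm v.LabelledDot] P]
    {h h' : TensorBimodule k v →ₗ[k[Equiv.Perm v.LabelledDot]] P}
    (H : ∀ η, h (TensorOver.tmul _ _ 1 (MonoidAlgebra.single η 1)) =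
      h' (TensorOver.tmul _ _ 1 (MonoidAlgebra.single η 1))) : h = h' := by
  have : (h.restrictScalars k) ∘ₗ TensorOver.tmulLin _ _ 1 =
      (h'.restrictScalars k) ∘ₗ TensorOver.tmulLin _ _ 1 :=
    MonoidAlgebra.lhom_ext' fun η => LinearMap.ext_ring (H η)
  exact TensorOver.hom_ext fun y => LinearMap.congr_fun this y

/-- The balancing relation for `ζ`: a factor `Π(ζ d)` crosses the tensor sign and becomes `ζ`. -/
theorem TensorBimodule.tmul_single_eq (ζ : v.stabParts) (η : Equiv.Perm (Fin n)) :
    (TensorOver.tmul _ _ 1 (MonoidAlgebra.single ((v.actDiagram ζ).perm * η) 1) :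
      TensorBimodule k v) =
    TensorOver.tmul _ _ (MonoidAlgebra.single (ζ : Equiv.Perm v.LabelledDot) 1)
      (MonoidAlgebra.single η 1) := by
  have := TensorOver.mul_tmul (MonoidAlgebra.mapDomainAlgHom k k v.stabParts.subtype)
    (v.stabAction k) 1 (MonoidAlgebra.single ζ 1) (MonoidAlgebra.single η 1)
  rw [one_mul, MonoidAlgebra.mapDomainAlgHom_apply, MonoidAlgebra.mapDomain_single] at this
  rw [Subgroup.subtype_apply] at this
  have h : v.stabAction k (MonoidAlgebra.single ζ 1) (MonoidAlgebra.single η 1) =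
      MonoidAlgebra.single ((v.actDiagram ζ).perm * η) 1 := by
    change MonoidAlgebra.mapDomain v.permHom (MonoidAlgebra.single ζ (1 : k)) *
      MonoidAlgebra.single η (1 : k) = _
    rw [MonoidAlgebra.mapDomain_single, MonoidAlgebra.single_mul_single, mul_one]
    rfl
  rw [this, h]

namespace TensorInduced

/-- The linear map `η ↦ (ζ̂ ⊗ 1)^{(i)}`, where `η = Π(ζ̂ d) σ_i`. -/
def ofPerm : k[Equiv.Perm (Fin n)] →ₗ[k] TensorInduced k σ :=
  Finsupp.linearCombination k (fun η => single k σ (σ.idx η) (Induced.of v (hat σ η))) ∘ₗ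
    (MonoidAlgebra.coeffLinearEquiv k).toLinearMap

theorem ofPerm_single {η : Equiv.Perm (Fin n)} {ζ : v.stabParts} {i : Fin s}
    (h : η = v.permHom ζ * σ.rep i) :
    ofPerm k σ (MonoidAlgebra.single η 1) = single k σ i (Induced.of v ζ) := by
  have hi : σ.idx η = i := σ.idx_eq (v.permHom_mem ζ) h
  have hh : v.permHom (hat σ η) = v.permHom ζ := by
    rw [permHom_hat, hi, h, mul_inv_cancel_right]
  have h1 : ofPerm k σ (MonoidAlgebra.single η 1) =
      single k σ (σ.idx η) (Induced.of v (hat σ η)) := by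
    change Finsupp.linearCombination k _ (Finsupp.single η 1) = _
    rw [Finsupp.linearCombination_single, one_smul]
  -- The chosen lift and `ζ` have the same image under `Π`, so they differ by `Σ_γ` and give the
  -- same class.
  have h2 := LinearMap.congr_fun (Induced.mulRight_congr (k := k) v hh) (Induced.of v 1)
  rw [Induced.mulRight_of, Induced.mulRight_of, one_mul, one_mul] at h2
  rw [h1, hi, h2]

/-- This makes `φ` well defined: if `η = Π(ζ d) σ_i`, then `Π(ξ d) η = Π(ξζ d) σ_i` lies in the same
coset and is lifted by `ξζ`. -/
theorem ofPerm_stabAction (r : k[v.stabParts]) (y : k[Equiv.Perm (Fin n)]) :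
    ofPerm k σ (v.stabAction k r y) =
      MonoidAlgebra.mapDomainAlgHom k k v.stabParts.subtype r • ofPerm k σ y := by
  induction r using MonoidAlgebra.induction_linear with
  | zero => simp
  | add r r' h h' => rw [map_add, LinearMap.add_apply, map_add, map_add, add_smul, h, h']
  | single ξ a =>
    induction y using MonoidAlgebra.induction_linear with
    | zero => simp
    | add y y' h h' => rw [map_add, map_add, map_add, smul_add, h, h']
    | single η b =>
      obtain ⟨i, ζ, h⟩ : ∃ i ζ, η = v.permHom ζ * σ.rep i :=
        ⟨_, hat σ η, by rw [permHom_hat, inv_mul_cancel_right]⟩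
      have h1 : v.stabAction k (MonoidAlgebra.single ξ a) (MonoidAlgebra.single η b) =
          (a * b) • MonoidAlgebra.single (v.permHom ξ * η) 1 := by
        change MonoidAlgebra.mapDomain v.permHom (MonoidAlgebra.single ξ a) *
          MonoidAlgebra.single η b = _
        simp
      have h2 : (MonoidAlgebra.single η b : k[Equiv.Perm (Fin n)]) =
          b • MonoidAlgebra.single η 1 := by simp
      rw [h1, map_smul, ofPerm_single k σ (i := i) (ζ := ξ * ζ) (by rw [map_mul, h, mul_assoc]), h2,
        map_smul, ofPerm_single k σ h, MonoidAlgebra.mapDomainAlgHom_apply,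
        MonoidAlgebra.mapDomain_single, smul_comm,
        ← (single k σ i).map_smul, Subgroup.subtype_apply, Induced.single_smul_of,
        LinearMap.map_smul_of_tower, smul_smul, mul_comm b a]
      rfl

/-- The map `τ ⊗ η ↦ (τ ζ̂ ⊗ 1)^{(i)}`, where `η = Π(ζ̂ d) σ_i`. -/
def ofTensor : TensorBimodule k v →ₗ[k[Equiv.Perm v.LabelledDot]] TensorInduced k σ :=
  TensorOver.lift (ofPerm k σ) (ofPerm_stabAction k σ)

theorem ofTensor_tmul (τ : Equiv.Perm v.LabelledDot) {η : Equiv.Perm (Fin n)} {ζ : v.stabParts}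
    {i : Fin s} (h : η = v.permHom ζ * σ.rep i) :
    ofTensor k σ (TensorOver.tmul _ _ (MonoidAlgebra.single τ 1) (MonoidAlgebra.single η 1)) =
      single k σ i (Induced.of v (τ * ζ)) := by
  rw [ofTensor, TensorOver.lift_tmul, ofPerm_single k σ h, ← map_smul, Induced.single_smul_of,
    one_smul]

/-- The map `(τ ⊗ 1)^{(i)} ↦ τ ⊗ σ_i`. -/
def toTensor : TensorInduced k σ →ₗ[k[Equiv.Perm v.LabelledDot]] TensorBimodule k v :=
  LinearMap.lsum _ (fun _ : Fin s => Induced k v) ℕ fun i =>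
    TensorOver.lift (LinearMap.toSpanSingleton k _
      (TensorOver.tmul _ _ 1 (MonoidAlgebra.single (σ.rep i) 1))) fun r c => by
      induction r using MonoidAlgebra.induction_linear with
      | zero => simp
      | add r r' h h' => rw [map_add, map_add, LinearMap.add_apply, map_add, h, h', add_smul]
      | single ζ a =>
        -- `Σ_γ` is the kernel of `Π`, so it fixes `1 ⊗ σ_i`.
        have h1 := TensorBimodule.tmul_single_eq k ⟨ζ, v.youngParts_le ζ.2⟩ (σ.rep i)
        have h2 : (v.actDiagram ζ).perm = 1 :=
          (v.permHom_eq_one_iff ⟨ζ, v.youngParts_le ζ.2⟩).2 ζ.2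
        rw [h2, one_mul] at h1
        have h3 : (MonoidAlgebra.single (ζ : Equiv.Perm v.LabelledDot) a :
            k[Equiv.Perm v.LabelledDot]) = a • MonoidAlgebra.single (ζ : Equiv.Perm _) 1 := by simp
        simp only [MonoidAlgebra.mapDomainAlgHom_apply, MonoidAlgebra.mapDomain_single,
          Subgroup.coe_subtype, Representation.asAlgebraHom_single, LinearMap.toSpanSingleton_apply,
          LinearMap.smul_apply, Representation.isTrivial_def, LinearMap.id_apply, smul_eq_mul]
        rw [h3, smul_assoc, smul_comm _ c, TensorOver.smul_tmul, mul_one, ← h1, mul_smul]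

theorem toTensor_single (i : Fin s) (τ : Equiv.Perm v.LabelledDot) :
    toTensor k σ (single k σ i (Induced.of v τ)) =
      TensorOver.tmul _ _ (MonoidAlgebra.single τ 1) (MonoidAlgebra.single (σ.rep i) 1) := by
  have e : toTensor k σ (single k σ i (Induced.of v τ)) = TensorOver.lift _ _ (Induced.of v τ) :=
    LinearMap.lsum_piSingle _ _ _ _ _ _
  rw [e, Induced.of, TensorOver.lift_tmul, LinearMap.toSpanSingleton_apply, one_smul,
    TensorOver.smul_tmul, mul_one]

theorem exists_eq_permHom_mul (η : Equiv.Perm (Fin n)) :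
    ∃ i ζ, η = v.permHom ζ * σ.rep i :=
  ⟨_, hat σ η, by rw [permHom_hat, inv_mul_cancel_right]⟩

/-- The isomorphism between `k Σ_{l₁} ⊗_{k ∏_α} k Σ_n` and the tensor induced module. -/
def equivTensor : TensorBimodule k v ≃ₗ[k[Equiv.Perm v.LabelledDot]] TensorInduced k σ :=
  LinearEquiv.ofLinearMap (ofTensor k σ) (toTensor k σ)
    (by
      apply TensorInduced.hom_ext
      intro i y
      refine LinearMap.congr_fun (f := ((ofTensor k σ).comp (toTensor k σ)).comp (single k σ i))
        (g := single k σ i) (Induced.hom_ext v ?_) y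
      rw [LinearMap.comp_apply, LinearMap.comp_apply, toTensor_single,
        ofTensor_tmul k σ 1 (i := i) (ζ := 1) (by rw [map_one, one_mul])]
      simp)
    (by
      apply TensorBimodule.hom_ext k
      intro η
      obtain ⟨i, ζ, h⟩ := exists_eq_permHom_mul σ η
      rw [LinearMap.comp_apply, MonoidAlgebra.one_def, ofTensor_tmul k σ 1 h, toTensor_single,
        one_mul, ← TensorBimodule.tmul_single_eq, h, ← MonoidAlgebra.one_def]
      rfl)

theorem smul_single (y : TensorInduced k σ) (η : Equiv.Perm (Fin n)) (a : k) :
    y <• (MonoidAlgebra.single η a : k[Equiv.Perm (Fin n)]) = a • act k σ η y := by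
  change MulOpposite.unop (MonoidAlgebra.lift k _ _ (actHom k σ) (MonoidAlgebra.single η a)) _ = _
  rw [MonoidAlgebra.lift_single]
  rfl

/-- By linearity it suffices to treat `1 ⊗ η'` and `η`. If `η' = Π(ζ d) σ_i` and `σ_i η = Π(ξ d)
σ_j`, then `η' η = Π(ζξ d) σ_j`, and both sides are `(ζξ ⊗ 1)^{(j)}`. -/
theorem equivTensor_smul (x : TensorBimodule k v) (b : k[Equiv.Perm (Fin n)]) :
    equivTensor k σ (x <• b) = equivTensor k σ x <• b := by
  induction b using MonoidAlgebra.induction_linear with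
  | zero => rw [MulOpposite.op_zero, zero_smul, zero_smul, map_zero]
  | add b b' h h' => rw [MulOpposite.op_add, add_smul, add_smul, map_add, h, h']
  | single η a =>
    rw [smul_single]
    have : (ofTensor k σ).comp (TensorBimodule.mulRight k v (MonoidAlgebra.single η a)) =
        a • (act k σ η).comp (ofTensor k σ) := by
      apply TensorBimodule.hom_ext k
      intro η'
      obtain ⟨i, ζ, h⟩ := exists_eq_permHom_mul σ η'
      obtain ⟨j, ξ, h'⟩ := exists_eq_permHom_mul σ (σ.rep i * η)
      have h2 : (MonoidAlgebra.single (η' * η) a : k[Equiv.Perm (Fin n)]) =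
          a • MonoidAlgebra.single (η' * η) 1 := by simp
      have h3 : (TensorOver.tmul _ _ 1 (a • MonoidAlgebra.single (η' * η) 1) :
          TensorBimodule k v) = a • TensorOver.tmul _ _ 1 (MonoidAlgebra.single (η' * η) 1) :=
        map_smul (TensorOver.tmulLin _ _ 1) a _
      rw [LinearMap.comp_apply, LinearMap.smul_apply, LinearMap.comp_apply,
        TensorBimodule.mulRight_tmul, MonoidAlgebra.single_mul_single, one_mul, h2, h3,
        LinearMap.map_smul_of_tower, MonoidAlgebra.one_def,
        ofTensor_tmul k σ 1 (i := j) (ζ := ζ * ξ) (by rw [h, mul_assoc, h', map_mul, mul_assoc]),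
        ofTensor_tmul k σ 1 h, act_single k σ η i j ξ h', Induced.mulRight_of, one_mul, one_mul]
      rfl
    exact LinearMap.congr_fun this x

end TensorInduced

end BimoduleIso

end PartialDiagram

/-! ### Transport of filtrations and conclusion -/

theorem DualSpechtFiltered.of_equiv {k X M M' : Type*} [CommRing k] [Fintype X] [DecidableEq X]
    [AddCommGroup M] [Module k[Equiv.Perm X] M] [AddCommGroup M'] [Module k[Equiv.Perm X] M']
    (e : M ≃ₗ[k[Equiv.Perm X]] M') (h : DualSpechtFiltered k X M) : DualSpechtFiltered k X M' := by
  obtain ⟨m, F, h0, h1, hF⟩ := h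
  refine ⟨m, fun i => (F i).map e.toLinearMap, ?_, ?_, fun i => ⟨?_, ?_⟩⟩
  · simp only [h0, Submodule.map_bot]
  · simp only [h1, Submodule.map_top, LinearEquiv.range]
  · exact Submodule.map_mono (hF i).1
  · obtain ⟨μ, hμ, ⟨f⟩⟩ := (hF i).2
    refine ⟨μ, hμ, ⟨(Submodule.Quotient.equiv ((F i.castSucc).submoduleOf (F i.succ)) _
      (e.submoduleMap (F i.succ)) ?_).symm.trans f⟩⟩
    ext ⟨y, hy⟩
    obtain ⟨x, hx, rfl⟩ := hy
    rw [Submodule.mem_map]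
    constructor
    · rintro ⟨⟨z, hz⟩, hz', hzx⟩
      exact ⟨z, hz', congrArg Subtype.val hzx⟩
    · rintro ⟨z, hz, hzx⟩
      have : z = x := e.injective hzx
      subst this
      exact ⟨⟨z, hx⟩, hz, rfl⟩

theorem PartialDiagram.gamma_eq_zero {l n : ℕ} (v : PartialDiagram l n) {j : ℕ}
    (h : v.gammaList.length ≤ j) : v.gamma j = 0 := List.getD_eq_default _ _ h

end

theorem mainTheorem6 {k : Type*} [Field k] {l n : ℕ} (v : PartialDiagram l n) {s : ℕ}
    (σ : CosetReps v.youngAlpha s) :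
    (∃ φ : PartialDiagram.TensorBimodule k v ≃ₗ[k[Equiv.Perm v.LabelledDot]] PartialDiagram.TensorInduced k σ,
      (∀ (x : PartialDiagram.TensorBimodule k v) (b : k[Equiv.Perm (Fin n)]), φ (x <• b) = φ x <• b) ∧
      ∀ (τ : Equiv.Perm v.LabelledDot) (η : Equiv.Perm (Fin n)) (ζ : v.stabParts) (i : Fin s),
        η = (v.actDiagram ζ).perm * σ.rep i →
        φ (TensorOver.tmul _ _ (MonoidAlgebra.single τ 1) (MonoidAlgebra.single η 1)) =
          PartialDiagram.TensorInduced.single k σ i (PartialDiagram.Induced.of v (τ * ζ))) ∧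
    Nonempty (PartialDiagram.TensorBimodule k v ≃ₗ[k[Equiv.Perm v.LabelledDot]]
      (Fin s → PermutationModule k v.LabelledDot v.gamma)) ∧
    DualSpechtFiltered k v.LabelledDot (PartialDiagram.TensorBimodule k v) := by
  obtain ⟨e⟩ := v.nonempty_induced_equiv k
  let φ := PartialDiagram.TensorInduced.equivTensor k σ
  let e' : PartialDiagram.TensorInduced k σ ≃ₗ[k[Equiv.Perm v.LabelledDot]]
      (Fin s → PermutationModule k v.LabelledDot v.gamma) := LinearEquiv.piCongrRight fun _ => e
  refine ⟨⟨φ, PartialDiagram.TensorInduced.equivTensor_smul k σ, fun τ η ζ i h =>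
    PartialDiagram.TensorInduced.ofTensor_tmul k σ τ h⟩, ⟨φ.trans e'⟩, ?_⟩
  exact (dualSpechtFiltered_permutationModule (J := v.gammaList.length)
    (fun _ hj => v.gamma_eq_zero hj) k s).of_equiv (φ.trans e').symm
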